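/- **Setting.** Fix integers $\ell\ge1$, $N_s\ge1$, put $L=\ell N_s$, and fix $\eta\in\mathbb C$, $q=e^{\eta}$, $[n]_q=(q^n-q^{-n})/(q-q^{-1})$, assuming $q\neq q^{-1}$ and $[n]_q\ne0$ for $1\le n\le \ell$. Let $[n]_q!=[n]_q\cdots[1]_q$ and $\binom{m}{n}_q=[m]_q!/([m-n]_q!\,[n]_q!)$. Fix $\xi_1,\dots,\xi_{N_s}\in\mathbb C$ and nonzero $g(0),\dots,g(\ell)\in\mathbb C$. The complete $\ell$-strings are $w^{(\ell)}_{\ell(b-1)+\beta}=\xi_b-(\beta-1)\eta$ ($1\le b\le N_s$, $1\le\beta\le\ell$), with centres $\Lambda_b=\xi_b-(\ell-1)\eta/2$. Let $\mathbb C^2$ have basis $|0\rangle,|1\rangle$, let $e^{a,b}$ be the $2\times2$ matrix unit and $e^{a,b}_k$ its action on the $k$th factor of $(\mathbb C^2)^{\otimes L}$; $|0\rangle$ also denotes the vacuum $|0\rangle^{\otimes L}$ and $\langle0|$ its transpose. *Spin-$\ell/2$ representation.* On $(\mathbb C^2)^{\otimes\ell}$ let $\Delta(X^-)=\sum_{k=1}^{\ell}1^{\otimes(k-1)}\otimes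 X^-\otimes (K^{-1})^{\otimes(\ell-k)}$ with $X^-=e^{1,0}$, $K^{-1}=\mathrm{diag}(q^{-1},q)$. For $0\le n\le\ell$ put $\|\ell,n\rangle=\Delta(X^-)^n|0\rangle^{\otimes\ell}/[n]_q!$, $F(\ell,n)=\|\ell,n\rangle^{T}\|\ell,n\rangle$, $\langle\ell,n\|=\|\ell,n\rangle^{T}/F(\ell,n)$, $P^{(\ell)}=\sum_{n=0}^{\ell}\|\ell,n\rangle\langle\ell,n\|$, and let $P$ be the product of the operators $P^{(\ell)}$ on the $N_s$ consecutive blocks of $\ell$ sites. *Monodromy matrices.* For a grading $w\in\{+,-,p\}$ let $\sigma(w)=1,-1,0$, respectively, and $$R^{(1\,w)}(u)=\begin{pmatrix}1&0&0&0\\0&b&c^-&0\\0&c^+&b&0\\0&0&0&1\end{pmatrix},\quad b=\frac{\sinh u}{\sinh(u+\eta)},\quad c^{\pm}=\frac{e^{\pm\sigma(w)u}\sinh\eta}{\sinh(u+\eta)}.$$ Let $T^{(\ell\,w;0)}(\lambda)=R^{(1\,w)}_{0L}(\lambda-w^{(\ell)}_L)\cdots R^{(1\,w)}_{01}(\lambda-w^{(\ell)}_1)$,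 where $0$ is an auxiliary copy of $\mathbb C^2$, and let $B^{(\ell\,w;0)}$, $C^{(\ell\,w;0)}$ be its $(0,1)$ and $(1,0)$ entries with respect to the auxiliary space. Let $\chi^{(\ell)}$ be the operator multiplying a basis vector of $(\mathbb C^2)^{\otimes L}$ that has $n_b$ entries $1$ in block $b$ by $e^{\sum_b n_b\Lambda_b}$ (so block $b$ contributes $e^{n\Lambda_b}$ on $\|\ell,n\rangle$), and let $\chi_0(\lambda)=\mathrm{diag}(1,e^{\lambda})\otimes\chi^{(\ell)}$. Put $$T^{(\ell\,+)}=P\,T^{(\ell\,+;0)}P,\qquad T^{(\ell\,p)}=\chi_0^{-1}T^{(\ell\,+)}\chi_0,\qquad T^{(\ell\,-)}=\chi_0^{-1}T^{(\ell\,p)}\chi_0,$$ and let $B^{(\ell\,w)}(\lambda)$, $C^{(\ell\,w)}(\lambda)$ be the $(0,1)$ and $(1,0)$ entries of $T^{(\ell\,w)}(\lambda)$. *Elementary operators.* For $0\le i,j\le\ell$ and $1\le k\le N_s$ let $\widehat E^{i,j\,(\ell\,p)}_k$ be $\frac{g(j)}{g(i)}\|\ell,i\rangle\langle\ell,j\|$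 acting on block $k$ (and as the identity on the other blocks), $\widehat E^{i,j\,(\ell\,\pm)}_k=(\chi^{(\ell)})^{\pm1}\,\widehat E^{i,j\,(\ell\,p)}_k\,(\chi^{(\ell)})^{\mp1}$, and $$\widehat N^{(\ell)}_{i,j}=\frac{g(j)}{g(i)}\binom{\ell}{i}_q\binom{\ell}{j}_q^{-1}q^{-i(\ell-i)/2+j(\ell-j)/2}\qquad(q^{x}=e^{\eta x}).$$ Let $S(n)$ be the set of sequences in $\{0,1\}^{\ell}$ with exactly $n$ ones. **Proposition 4.2.** Let $w\in\{+,-,p\}$ and let $\mu_1,\dots,\mu_N$, $\lambda_1,\dots,\lambda_M$ be arbitrary complex numbers, none of them of the form $w^{(\ell)}_k-\eta+n\pi\sqrt{-1}$ with $1\le k\le L$, $n\in\mathbb Z$. Let $0\le i_1,j_1\le\ell$ with $i_1-j_1=N-M$, and fix any $\varepsilon'\in S(i_1)$. Then $$\langle0|\prod_{\alpha=1}^{N}C^{(\ell\,w)}(\mu_\alpha)\;\widehat E^{i_1,j_1\,(\ell\,w)}_1\;\prod_{\beta=1}^{M}B^{(\ell\,w)}(\lambda_\beta)|0\rangle=\widehat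 N^{(\ell)}_{i_1,j_1}\,e^{\sigma(w)(\sum_\alpha\mu_\alpha-\sum_\beta\lambda_\beta)}\sum_{\varepsilon\in S(j_1)}\langle0|\prod_{\alpha=1}^{N}C^{(\ell\,p;0)}(\mu_\alpha)\;e_1^{\varepsilon'_1,\varepsilon_1}\cdots e_\ell^{\varepsilon'_\ell,\varepsilon_\ell}\;\prod_{\beta=1}^{M}B^{(\ell\,p;0)}(\lambda_\beta)|0\rangle .$$ Moreover each summand is symmetric in $\varepsilon'$: for every $\varepsilon\in S(j_1)$ it is unchanged when $\varepsilon'_1,\dots,\varepsilon'_\ell$ is replaced by $\varepsilon'_{\pi1},\dots,\varepsilon'_{\pi\ell}$, for any permutation $\pi\in\mathcal S_\ell$. **Products of $m$ operators (Corollary 4.3).** Likewise, let $0\le m\le N_s$, let $0\le i_k,j_k\le\ell$ for $1\le k\le m$ with $\sum_k i_k-\sum_k j_k=N-M$, and fix $\varepsilon^{[k]\prime}\in S(i_k)$ for each $k$. Then $$\langle0|\prod_{\alpha=1}^{N}C^{(\ell\,w)}(\mu_\alpha)\prod_{k=1}^{m}\widehat E^{i_k,j_k\,(\ell\,w)}_k\prod_{\beta=1}^{M}B^{(\ell\,w)}(\lambda_\beta)|0\rangle=\Big(\prod_{k=1}^{m}\widehat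 N^{(\ell)}_{i_k,j_k}\Big)e^{\sigma(w)(\sum_\alpha\mu_\alpha-\sum_\beta\lambda_\beta)}\sum_{\varepsilon^{[1]}\in S(j_1)}\cdots\sum_{\varepsilon^{[m]}\in S(j_m)}\langle0|\prod_{\alpha=1}^{N}C^{(\ell\,p;0)}(\mu_\alpha)\prod_{k=1}^{m}\Big(e_{\ell(k-1)+1}^{\varepsilon^{[k]\prime}_1,\varepsilon^{[k]}_1}\cdots e_{\ell(k-1)+\ell}^{\varepsilon^{[k]\prime}_\ell,\varepsilon^{[k]}_\ell}\Big)\prod_{\beta=1}^{M}B^{(\ell\,p;0)}(\lambda_\beta)|0\rangle ,$$ and each summand is unchanged when, for every $k$, the entries of $\varepsilon^{[k]\prime}$ are permuted by any $\pi^{[k]}\in\mathcal S_\ell$. -/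

import Mathlib

noncomputable section

namespace HigherSpinXXZ

open Matrix

/-! ### Gradings and q-analogues -/

/-- The gradings `+`, `-` (homogeneous) and `p` (principal). -/
inductive Grading where
  | plus
  | minus
  | principal

/-- `σ(w)`, equal to `1`, `-1`, `0` for `w = +, -, p`. -/
def Grading.sgn : Grading → ℂ
  | .plus => 1
  | .minus => -1
  | .principal => 0

/-- The q-integer `[n]_q = (q^n - q^{-n}) / (q - q^{-1})`. -/
def qInt (q : ℂ) (n : ℕ) : ℂ := (q ^ n - (q ^ n)⁻¹) / (q - q⁻¹)

/-- The q-factorial `[n]_q! = [n]_q [n-1]_q ⋯ [1]_q`. -/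
def qFact (q : ℂ) (n : ℕ) : ℂ := ∏ k ∈ Finset.range n, qInt q (k + 1)

/-- The q-binomial coefficient `[m]_q! / ([m-n]_q! [n]_q!)`, for `n ≤ m`. -/
def qBinom (q : ℂ) (m n : ℕ) : ℂ := qFact q m / (qFact q (m - n) * qFact q n)

/-! ### Operators on the tensor product of `L` copies of `ℂ²` -/

/-- Labels of the standard basis of `(ℂ²)^{⊗ L}` (`0` is spin up, `1` is spin down). -/
abbrev Config (L : ℕ) := Fin L → Fin 2

/-- Operators on `(ℂ²)^{⊗ L}`. -/
abbrev Op (L : ℕ) := Matrix (Config L) (Config L) ℂ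

/-- Operators on `ℂ² ⊗ (ℂ²)^{⊗ L}`; the first factor is the auxiliary space. -/
abbrev AuxOp (L : ℕ) := Matrix (Fin 2 × Config L) (Fin 2 × Config L) ℂ

/-- The vacuum vector `|0⟩ = |↑⟩ ⊗ ⋯ ⊗ |↑⟩`. -/
def vac (L : ℕ) : Config L → ℂ := Pi.single (fun _ => 0) 1

/-- The vacuum matrix element `⟨0| X |0⟩`. -/
def vev {L : ℕ} (X : Op L) : ℂ := vac L ⬝ᵥ (X *ᵥ vac L)

/-- The tensor product `X_1 ⊗ ⋯ ⊗ X_L` of one-site operators. -/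
def tensorOp {L : ℕ} (X : Fin L → Matrix (Fin 2) (Fin 2) ℂ) : Op L :=
  fun s t => ∏ j, X j (s j) (t j)

/-- The one-site operator `X` acting on site `k` and as the identity on the other sites. -/
def onSite {L : ℕ} (k : Fin L) (X : Matrix (Fin 2) (Fin 2) ℂ) : Op L :=
  fun s t => if ∀ j, j ≠ k → s j = t j then X (s k) (t k) else 0

/-- The one-site elementary operator `e^{a,b}`, with its only nonzero entry at `(a, b)`. -/
def eUnit (a b : Fin 2) : Matrix (Fin 2) (Fin 2) ℂ := Matrix.single a b 1

/-! ### The spin-`ℓ/2` representation inside `(ℂ²)^{⊗ ℓ}` -/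

/-- The action of `X⁻` on `(ℂ²)^{⊗ ℓ}` by the iterated coproduct with
`Δ(X⁻) = X⁻ ⊗ K⁻¹ + 1 ⊗ X⁻`, i.e. the sum over `k` of
`1 ⊗ ⋯ ⊗ 1 ⊗ X⁻ ⊗ K⁻¹ ⊗ ⋯ ⊗ K⁻¹` (`X⁻` in position `k`), where `X⁻|0⟩ = |1⟩`,
`X⁻|1⟩ = 0` and `K⁻¹ = diag(q⁻¹, q)`. -/
def deltaXMinus (q : ℂ) (ℓ : ℕ) : Op ℓ :=
  ∑ k : Fin ℓ, tensorOp fun j =>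
    if j = k then eUnit 1 0 else if k < j then Matrix.diagonal ![q⁻¹, q] else 1

/-- The basis vector `||ℓ, n⟩ = (Δ(X⁻))^n |0 ⋯ 0⟩ / [n]_q!`. -/
def ket (q : ℂ) (ℓ n : ℕ) : Config ℓ → ℂ :=
  (qFact q n)⁻¹ • ((deltaXMinus q ℓ ^ n) *ᵥ vac ℓ)

/-- The square length `F(ℓ, n) = (||ℓ, n⟩)ᵀ · ||ℓ, n⟩` (no complex conjugation). -/
def sqLength (q : ℂ) (ℓ n : ℕ) : ℂ := ket q ℓ n ⬝ᵥ ket q ℓ n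

/-- The conjugate vector `⟨ℓ, n|| = (||ℓ, n⟩)ᵀ / F(ℓ, n)`. -/
def bra (q : ℂ) (ℓ n : ℕ) : Config ℓ → ℂ := (sqLength q ℓ n)⁻¹ • ket q ℓ n

/-- The projection operator `P^{(ℓ)} = ∑_{n=0}^{ℓ} ||ℓ, n⟩⟨ℓ, n||`. -/
def proj (q : ℂ) (ℓ : ℕ) : Op ℓ :=
  ∑ n ∈ Finset.range (ℓ + 1), Matrix.vecMulVec (ket q ℓ n) (bra q ℓ n)

/-! ### The chain of `Ns` blocks of `ℓ` sites -/

/-- The `β`-th site of the `b`-th block, i.e. number `ℓ b + β` (counting from zero). -/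
def site {Ns ℓ : ℕ} (b : Fin Ns) (β : Fin ℓ) : Fin (Ns * ℓ) := finProdFinEquiv (b, β)

/-- An operator on `(ℂ²)^{⊗ ℓ}` acting on block `b` and as the identity on the other blocks. -/
def onBlock {Ns ℓ : ℕ} (b : Fin Ns) (X : Op ℓ) : Op (Ns * ℓ) :=
  fun s t =>
    if ∀ c β, c ≠ b → s (site c β) = t (site c β) then
      X (fun β => s (site b β)) (fun β => t (site b β))
    else 0

/-- The projection `P^{(ℓ)}_{1⋯L} = ∏_b P^{(ℓ)}_{ℓ(b-1)+1}` onto `(V^{(ℓ)})^{⊗ Ns}`. -/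
def projAll (q : ℂ) (ℓ Ns : ℕ) : Op (Ns * ℓ) :=
  (List.ofFn fun b : Fin Ns => onBlock b (proj q ℓ)).prod

/-- The complete `ℓ`-strings: the inhomogeneity parameter at the `β`-th site of the `b`-th block
is `ξ_b - β η` (with `β = 0, …, ℓ - 1`). -/
def stringParam {Ns : ℕ} (ℓ : ℕ) (η : ℂ) (ξ : Fin Ns → ℂ) : Fin (Ns * ℓ) → ℂ :=
  fun k => ξ k.divNat - ((k.modNat : ℕ) : ℂ) * η

/-- The string centre `Λ_b = ξ_b - (ℓ - 1) η / 2`. -/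
def stringCenter {Ns : ℕ} (ℓ : ℕ) (η : ℂ) (ξ : Fin Ns → ℂ) (b : Fin Ns) : ℂ :=
  ξ b - ((ℓ : ℂ) - 1) * η / 2

/-! ### `R`-matrix and spin-1/2 monodromy matrix -/

/-- The `R`-matrix `R^{(1 w)}(u)`; the nonzero entries are `1` at `(00,00)` and `(11,11)`,
`b(u) = sinh u / sinh (u+η)` at `(01,01)` and `(10,10)`, and
`c^∓(u) = exp(∓ σ(w) u) sinh η / sinh (u+η)` at `(01,10)` and at `(10,01)`. -/
def rMatrix (w : Grading) (η u : ℂ) : Matrix (Fin 2 × Fin 2) (Fin 2 × Fin 2) ℂ :=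
  fun x y =>
    if x = y then
      if x.1 = x.2 then 1 else Complex.sinh u / Complex.sinh (u + η)
    else if x = (0, 1) ∧ y = (1, 0) then
      Complex.exp (-(w.sgn * u)) * Complex.sinh η / Complex.sinh (u + η)
    else if x = (1, 0) ∧ y = (0, 1) then
      Complex.exp (w.sgn * u) * Complex.sinh η / Complex.sinh (u + η)
    else 0

/-- `R^{(1 w)}_{0k}(u)`, acting on the auxiliary space and the `k`-th site. -/
def rOp {L : ℕ} (w : Grading) (η u : ℂ) (k : Fin L) : AuxOp L :=
  fun x y =>
    if ∀ j, j ≠ k → x.2 j = y.2 j then rMatrix w η u (x.1, x.2 k) (y.1, y.2 k) else 0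

/-- The spin-1/2 monodromy matrix
`T^{(1,1 w)}(x; {w_j}) = R_{0L}(x - w_L) ⋯ R_{01}(x - w_1)`. -/
def monodromy {L : ℕ} (w : Grading) (η : ℂ) (v : Fin L → ℂ) (x : ℂ) : AuxOp L :=
  (List.ofFn fun k : Fin L => rOp w η (x - v k) k).reverse.prod

/-- The `(a, b)` entry, with respect to the auxiliary space, of an operator on
`ℂ² ⊗ (ℂ²)^{⊗ L}`; it is an operator on `(ℂ²)^{⊗ L}`. -/
def auxEntry {L : ℕ} (T : AuxOp L) (a b : Fin 2) : Op L := fun s t => T (a, s) (b, t)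

/-- `T^{(1,ℓ w;0)}(x)`, the spin-1/2 monodromy matrix at the complete `ℓ`-strings. -/
def stringMonodromy {Ns : ℕ} (ℓ : ℕ) (w : Grading) (η : ℂ) (ξ : Fin Ns → ℂ) (x : ℂ) :
    AuxOp (Ns * ℓ) :=
  monodromy w η (stringParam ℓ η ξ) x

/-- `B^{(ℓ w;0)}(x)`. -/
def opB0 {Ns : ℕ} (ℓ : ℕ) (w : Grading) (η : ℂ) (ξ : Fin Ns → ℂ) (x : ℂ) : Op (Ns * ℓ) :=
  auxEntry (stringMonodromy ℓ w η ξ x) 0 1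

/-- `C^{(ℓ w;0)}(x)`. -/
def opC0 {Ns : ℕ} (ℓ : ℕ) (w : Grading) (η : ℂ) (ξ : Fin Ns → ℂ) (x : ℂ) : Op (Ns * ℓ) :=
  auxEntry (stringMonodromy ℓ w η ξ x) 1 0

/-! ### Gauge transformations and the spin-`ℓ/2` monodromy matrix -/

/-- `Φ(x) = diag(1, exp x)`. -/
def phi (x : ℂ) : Matrix (Fin 2) (Fin 2) ℂ := Matrix.diagonal ![1, Complex.exp x]

/-- `Φ^{(ℓ)}(x)`: multiplication by `exp(n x)` on basis vectors with `n` down spins, so that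
`Φ^{(ℓ)}(x) ||ℓ, n⟩ = exp(n x) ||ℓ, n⟩`. -/
def phiBlock (ℓ : ℕ) (x : ℂ) : Op ℓ :=
  Matrix.diagonal fun s => Complex.exp (((Finset.univ.filter fun β => s β = 1).card : ℂ) * x)

/-- The spin-`ℓ/2` gauge transformation `χ^{(ℓ)} = Φ^{(ℓ)}_1(Λ_1) ⋯ Φ^{(ℓ)}_{Ns}(Λ_{Ns})`. -/
def gauge {Ns : ℕ} (ℓ : ℕ) (η : ℂ) (ξ : Fin Ns → ℂ) : Op (Ns * ℓ) :=
  (List.ofFn fun b : Fin Ns => onBlock b (phiBlock ℓ (stringCenter ℓ η ξ b))).prod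

/-- The gauge transformation `χ^{(1,ℓ)}_0 = Φ_0(x) χ^{(ℓ)}` including the auxiliary space. -/
def auxGauge {Ns : ℕ} (ℓ : ℕ) (η : ℂ) (ξ : Fin Ns → ℂ) (x : ℂ) : AuxOp (Ns * ℓ) :=
  Matrix.kronecker (phi x) (gauge ℓ η ξ)

/-- The spin-`ℓ/2` monodromy matrix `T^{(ℓ w)}(x)` on the `Ns`-site spin-`ℓ/2` chain. For `w = +`
it is `P T^{(1,ℓ +;0)}(x) P`; the gauge transformation maps `w = p` to `w = +`, and likewise
`w = -` to `w = p`. -/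
def fusedMonodromy {Ns : ℕ} (ℓ : ℕ) (w : Grading) (η : ℂ) (ξ : Fin Ns → ℂ) (x : ℂ) :
    AuxOp (Ns * ℓ) :=
  let P : AuxOp (Ns * ℓ) :=
    Matrix.kronecker (1 : Matrix (Fin 2) (Fin 2) ℂ) (projAll (Complex.exp η) ℓ Ns)
  let G := auxGauge ℓ η ξ x
  let Tplus := P * stringMonodromy ℓ .plus η ξ x * P
  match w with
  | .plus => Tplus
  | .principal => G⁻¹ * Tplus * G
  | .minus => G⁻¹ * (G⁻¹ * Tplus * G) * G

/-- `B^{(ℓ w)}(x)`. -/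
def opB {Ns : ℕ} (ℓ : ℕ) (w : Grading) (η : ℂ) (ξ : Fin Ns → ℂ) (x : ℂ) : Op (Ns * ℓ) :=
  auxEntry (fusedMonodromy ℓ w η ξ x) 0 1

/-- `C^{(ℓ w)}(x)`. -/
def opC {Ns : ℕ} (ℓ : ℕ) (w : Grading) (η : ℂ) (ξ : Fin Ns → ℂ) (x : ℂ) : Op (Ns * ℓ) :=
  auxEntry (fusedMonodromy ℓ w η ξ x) 1 0

/-! ### General spin-`ℓ/2` elementary operators -/

/-- The general elementary operator `Ê_k^{i,j (ℓ w)}` on the `k`-th spin-`ℓ/2` site: for `w = p`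
it is `||ℓ, i⟩⟨ℓ, j|| g(j) / g(i)` on block `k`, and the other gradings are obtained by the gauge
transformation, exactly as for the monodromy matrix. -/
def opE {Ns : ℕ} (ℓ : ℕ) (w : Grading) (η : ℂ) (ξ : Fin Ns → ℂ) (g : ℕ → ℂ)
    (k : Fin Ns) (i j : ℕ) : Op (Ns * ℓ) :=
  let q := Complex.exp η
  let Ep : Op (Ns * ℓ) :=
    onBlock k ((g j / g i) • Matrix.vecMulVec (ket q ℓ i) (bra q ℓ j))
  let G := gauge ℓ η ξ
  match w with
  | .plus => G * Ep * G⁻¹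
  | .principal => Ep
  | .minus => G⁻¹ * Ep * G

/-- The normalization factor `N̂_{i,j}^{(ℓ)} = (g(j)/g(i)) N_{i,j}^{(ℓ)}`, where
`N_{i,j}^{(ℓ)}` is the ratio of the q-binomial coefficients `[ℓ, i]_q` and `[ℓ, j]_q` times
`q^{-i(ℓ-i)/2 + j(ℓ-j)/2}`, with `q = exp η`. -/
def normHat (ℓ : ℕ) (η : ℂ) (g : ℕ → ℂ) (i j : ℕ) : ℂ :=
  g j / g i * (qBinom (Complex.exp η) ℓ i / qBinom (Complex.exp η) ℓ j) *
    Complex.exp (η * (-((i : ℂ) * ((ℓ : ℂ) - i)) / 2 + (j : ℂ) * ((ℓ : ℂ) - j) / 2))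

/-! ### Matrix elements -/

/-- The 0-1 sequences of length `ℓ` with exactly `n` ones. -/
def seqs (ℓ n : ℕ) : Finset (Fin ℓ → Fin 2) :=
  Finset.univ.filter fun s => (Finset.univ.filter fun β => s β = 1).card = n

/-- The product `e_{ℓ(k-1)+1}^{a_1,b_1} ⋯ e_{ℓ(k-1)+ℓ}^{a_ℓ,b_ℓ}` over the sites of block `k`. -/
def eBlock {Ns ℓ : ℕ} (k : Fin Ns) (a b : Fin ℓ → Fin 2) : Op (Ns * ℓ) :=
  (List.ofFn fun β : Fin ℓ => onSite (site k β) (eUnit (a β) (b β))).prod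

/-- The spin-`ℓ/2` off-shell matrix element
`⟨0| ∏_α C^{(ℓ w)}(μ_α) · X · ∏_β B^{(ℓ w)}(lam_β) |0⟩`. -/
def fusedElement {Ns N M : ℕ} (ℓ : ℕ) (w : Grading) (η : ℂ) (ξ : Fin Ns → ℂ)
    (μ : Fin N → ℂ) (lam : Fin M → ℂ) (X : Op (Ns * ℓ)) : ℂ :=
  vev ((List.ofFn fun α => opC ℓ w η ξ (μ α)).prod * X *
    (List.ofFn fun β => opB ℓ w η ξ (lam β)).prod)

/-- The spin-1/2 off-shell matrix element
`⟨0| ∏_α C^{(ℓ w;0)}(μ_α) · X · ∏_β B^{(ℓ w;0)}(lam_β) |0⟩` at the complete `ℓ`-strings. -/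
def halfElement {Ns N M : ℕ} (ℓ : ℕ) (w : Grading) (η : ℂ) (ξ : Fin Ns → ℂ)
    (μ : Fin N → ℂ) (lam : Fin M → ℂ) (X : Op (Ns * ℓ)) : ℂ :=
  vev ((List.ofFn fun α => opC0 ℓ w η ξ (μ α)).prod * X *
    (List.ofFn fun β => opB0 ℓ w η ξ (lam β)).prod)

/-- The spectral parameter `x` avoids the points `w_k^{(ℓ)} - η + n π i` (`n ∈ ℤ`), the poles of
the monodromy matrix at the complete `ℓ`-strings. -/
def IsRegularParam {Ns : ℕ} (ℓ : ℕ) (η : ℂ) (ξ : Fin Ns → ℂ) (x : ℂ) : Prop :=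
  ∀ (k : Fin (Ns * ℓ)) (n : ℤ),
    x ≠ stringParam ℓ η ξ k - η + (n : ℂ) * (Real.pi : ℂ) * Complex.I

end HigherSpinXXZ

end

open HigherSpinXXZ

noncomputable section

namespace HigherSpinXXZ

open Matrix

/-! ### Explicit form of the spin-`ℓ/2` basis vectors -/

/-! A matrix element is read from left to right, as a row vector that starts at the vacuum and is
acted on by successive operators. In the principal grading this row vector stays symmetric under
permutations of the sites inside each block. The vacuum is symmetric, and neighbouring
inhomogeneities of a string differ by exactly the shift `η` for which the product of two
neighbouring R-matrices preserves symmetry (`rOp_mul_rOp_mem_invariancePreserving`,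
`BlockSymmetric.vecMul_auxEntry`).

The vector `ket q ℓ n` has amplitude proportional to `q ^ tilt s` on configurations with `n` down
spins (`deltaXMinus_pow_vac`). A diagonal similarity therefore turns the fusion projector into
`symProj`, a weighted average over configurations with equal down count, which fixes every symmetric
row vector (`vecMul_symProjAll`). The decisive coincidence is `gaugeExponent_plus`: for the grading
`+`, this similarity is also the gauge that carries the principal spin-1/2 monodromy matrix to the
grading `+`. The other gradings differ by a power of `gauge`, which commutes with the projector.
Thus a single conjugation symmetrises all operators at once (`auxEntry_fusedMonodromy`,
`opE_eq_conj`). It is trivial on the vacuum and leaves only the exponential prefactors of the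
auxiliary space.

All projectors then drop out. An elementary operator applied to a symmetric row vector sums `q ^ (2
* tilt)` over the configurations with `i` down spins, which is a Gaussian binomial
(`tiltSum_mul_qFact`). What remains is one arbitrary representative on the left and a free sum on
the right (`vecMul_onBlock_symE_eq_sum`). The result is again symmetric, so the argument continues
through further operators. Symmetry in the representative is the symmetry of the row vector to its
left. -/

/-- The number of down spins of a configuration. -/
def downCount {ℓ : ℕ} (s : Config ℓ) : ℕ := (Finset.univ.filter fun β => s β = 1).card

theorem mem_seqs {ℓ n : ℕ} {s : Config ℓ} : s ∈ seqs ℓ n ↔ downCount s = n := by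
  simp [seqs, downCount]

/-- The sum over the down spins of their positions relative to the centre of the block. -/
def tilt {ℓ : ℕ} (s : Config ℓ) : ℂ :=
  ∑ β : Fin ℓ, if s β = 1 then ((β : ℕ) : ℂ) - ((ℓ : ℂ) - 1) / 2 else 0

/-- The number of larger elements takes each value below `A.card` exactly once. Inserting a new
minimum leaves the earlier counts alone and adds the top one. -/
theorem sum_pow_rank {α R : Type*} [LinearOrder α] [CommSemiring R] (x : R) (A : Finset α) :
    ∑ k ∈ A, x ^ (A.filter fun j => k < j).card = ∑ i ∈ Finset.range A.card, x ^ i := by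
  induction A using Finset.induction_on_min with
  | empty => simp
  | insert a s ha ih =>
    have hna : a ∉ s := fun h => lt_irrefl _ (ha a h)
    rw [Finset.sum_insert hna, Finset.card_insert_of_notMem hna, Finset.sum_range_succ, ← ih,
      add_comm]
    congr 1
    · refine Finset.sum_congr rfl fun k hk => ?_
      rw [Finset.filter_insert, if_neg (not_lt.2 (ha k hk).le)]
    · rw [Finset.filter_insert, if_neg (lt_irrefl a), Finset.filter_true_of_mem ha]

/-- Multiplication by `q - q⁻¹` makes the sum telescope. The hypothesis encodes `q ≠ q⁻¹`, since
division by zero would make `qInt q 1` vanish. -/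
theorem sum_exp_eq_qInt {η : ℂ} (h : qInt (Complex.exp η) 1 ≠ 0) (n : ℕ) :
    ∑ i ∈ Finset.range n, Complex.exp (η * (2 * i - (n - 1))) = qInt (Complex.exp η) n := by
  have hq : Complex.exp η - (Complex.exp η)⁻¹ ≠ 0 := by
    intro h0; apply h; simp [qInt, h0]
  have h0 := Complex.exp_ne_zero η
  have key : ∀ i : ℕ, Complex.exp (η * (2 * i - (n - 1))) * (Complex.exp η - (Complex.exp η)⁻¹) =
      Complex.exp (η * (2 * ((i + 1 : ℕ) : ℂ) - n)) - Complex.exp (η * (2 * (i : ℂ) - n)) := by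
    intro i
    rw [← Complex.exp_neg, mul_sub, ← Complex.exp_add, ← Complex.exp_add]
    congr 2 <;> push_cast <;> ring
  rw [qInt, eq_div_iff hq, Finset.sum_mul, Finset.sum_congr rfl fun i _ => key i,
    Finset.sum_range_sub fun i : ℕ => Complex.exp (η * (2 * (i : ℂ) - n))]
  rw [← Complex.exp_nat_mul, ← Complex.exp_neg]
  congr 2 <;> push_cast <;> ring

theorem tensorOp_lower_mulVec {ℓ : ℕ} (q : ℂ) (k : Fin ℓ) (v : Config ℓ → ℂ) (s : Config ℓ) :
    (tensorOp (fun j => if j = k then eUnit 1 0 else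
      if k < j then Matrix.diagonal ![q⁻¹, q] else 1) *ᵥ v) s =
      if s k = 1 then (∏ j, if k < j then ![q⁻¹, q] (s j) else 1) * v (Function.update s k 0)
      else 0 := by
  simp only [mulVec, dotProduct, tensorOp]
  rw [Finset.sum_eq_single (Function.update s k 0)]
  · split_ifs with h
    · congr 1
      refine Finset.prod_congr rfl fun j _ => ?_
      by_cases hj : j = k
      · subst hj; simp [eUnit, h]
      · by_cases hk : k < j <;> simp [hj, hk, Matrix.one_apply]
    · rw [Finset.prod_eq_zero (Finset.mem_univ k), zero_mul]
      simp [eUnit, Ne.symm h]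
  · intro t _ ht
    have : ∃ j, t j ≠ Function.update s k 0 j := by
      by_contra! hh; exact ht (funext hh)
    obtain ⟨j, hj⟩ := this
    rw [Finset.prod_eq_zero (Finset.mem_univ j), zero_mul]
    by_cases hjk : j = k
    · subst hjk; simp at hj; simp [eUnit, Ne.symm hj]
    · rw [Function.update_of_ne hjk] at hj
      by_cases hk : k < j <;> simp [hjk, hk, Ne.symm hj]
  · simp

theorem downCount_update {ℓ : ℕ} {s : Config ℓ} {k : Fin ℓ} (h : s k = 1) :
    downCount (Function.update s k 0) + 1 = downCount s := by
  have : (Finset.univ.filter fun β => Function.update s k 0 β = 1) =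
      (Finset.univ.filter fun β => s β = 1).erase k := by
    ext j; by_cases hj : j = k
    · subst hj; simp
    · simp [hj]
  rw [downCount, this, Finset.card_erase_add_one (by simpa using h)]; rfl

theorem tilt_update {ℓ : ℕ} {s : Config ℓ} {k : Fin ℓ} (h : s k = 1) :
    tilt (Function.update s k 0) = tilt s - ((k : ℕ) - ((ℓ : ℂ) - 1) / 2) := by
  rw [tilt, tilt, ← Finset.add_sum_erase _ _ (Finset.mem_univ k),
    ← Finset.add_sum_erase (a := k) Finset.univ (fun β => if s β = 1 then _ else _)
      (Finset.mem_univ k)]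
  simp only [h, Function.update_self, if_true, zero_ne_one, if_false]
  rw [zero_add, add_sub_cancel_left]
  refine Finset.sum_congr rfl fun j hj => ?_
  rw [Function.update_of_ne (Finset.ne_of_mem_erase hj)]

theorem prod_diag_right {ℓ : ℕ} (η : ℂ) (k : Fin ℓ) (s : Config ℓ) :
    (∏ j, if k < j then ![(Complex.exp η)⁻¹, Complex.exp η] (s j) else 1) =
      Complex.exp (η * (2 * ((((Finset.univ.filter fun β => s β = 1).filter
        fun j => k < j).card : ℕ) : ℂ) - ((ℓ : ℂ) - 1 - (k : ℕ)))) := by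
  have h1 : ∀ j : Fin ℓ, (if k < j then ![(Complex.exp η)⁻¹, Complex.exp η] (s j) else 1) =
      Complex.exp (η * (2 * (if s j = 1 ∧ k < j then 1 else 0) - if k < j then 1 else 0)) := by
    intro j
    by_cases hk : k < j
    · obtain h | h : s j = 0 ∨ s j = 1 := by omega
      · simp [hk, h, Complex.exp_neg]
      · simp only [hk, h, and_self, if_true]
        norm_num
    · simp [hk]
  have h2 : (∑ j : Fin ℓ, if k < j then (1 : ℂ) else 0) = (ℓ : ℂ) - 1 - (k : ℕ) := by
    rw [Finset.sum_boole, show (Finset.univ.filter fun j => k < j) = Finset.Ioi k by ext; simp,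
      Fin.card_Ioi, Nat.sub_sub,
      Nat.cast_sub (by omega)]
    push_cast; ring
  rw [Finset.prod_congr rfl fun j _ => h1 j, ← Complex.exp_sum, ← Finset.mul_sum,
    Finset.sum_sub_distrib, h2, ← Finset.mul_sum, Finset.sum_boole, Finset.filter_filter]

/-- Any down spin of `s` may be the last one lowered. The corresponding weights form a geometric
progression, whose sum supplies the next factor of the q-factorial. -/
theorem deltaXMinus_pow_vac {η : ℂ} (h : qInt (Complex.exp η) 1 ≠ 0) (ℓ n : ℕ) (s : Config ℓ) :
    ((deltaXMinus (Complex.exp η) ℓ ^ n) *ᵥ vac ℓ) s =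
      if downCount s = n then
        qFact (Complex.exp η) n * Complex.exp (η * (tilt s - n * ((ℓ : ℂ) - n) / 2)) else 0 := by
  induction n generalizing s with
  | zero =>
    have : downCount s = 0 ↔ s = fun _ => 0 := by
      rw [downCount, Finset.card_eq_zero, Finset.filter_eq_empty_iff]
      constructor
      · intro hs; funext j; have := hs (Finset.mem_univ j); omega
      · rintro rfl; simp
    by_cases hs : s = fun _ => 0
    · rw [if_pos (this.2 hs)]; subst hs; simp [vac, qFact, tilt]
    · rw [if_neg (mt this.1 hs)]; simp [vac, hs]
  | succ n ih =>
    rw [pow_succ', ← mulVec_mulVec, deltaXMinus, sum_mulVec, Finset.sum_apply]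
    rw [Finset.sum_congr rfl fun k _ => tensorOp_lower_mulVec _ k _ s]
    rw [← deltaXMinus, ← Finset.sum_filter]
    split_ifs with hs
    -- The position of `k` enters both through the `K⁻¹` factors to its right and through the change
    -- of `tilt`. These contributions cancel, so only the rank of `k` among the down spins survives.
    · have hterm : ∀ k ∈ Finset.univ.filter fun β => s β = 1,
          (∏ j, if k < j then ![(Complex.exp η)⁻¹, Complex.exp η] (s j) else 1) *
            ((deltaXMinus (Complex.exp η) ℓ ^ n) *ᵥ vac ℓ) (Function.update s k 0) =
          qFact (Complex.exp η) n *
            Complex.exp (η * (tilt s - (n + 1 : ℕ) * ((ℓ : ℂ) - (n + 1 : ℕ)) / 2)) *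
            (Complex.exp (η * (-n)) * Complex.exp (η * 2) ^
              ((Finset.univ.filter fun β => s β = 1).filter fun j => k < j).card) := by
        intro k hk
        have hk1 : s k = 1 := by simpa using hk
        have hc := downCount_update hk1
        rw [ih, if_pos (by omega), prod_diag_right, tilt_update hk1, ← Complex.exp_nat_mul,
          mul_left_comm, ← Complex.exp_add, mul_assoc, ← Complex.exp_add, ← Complex.exp_add]
        congr 2
        push_cast; ring
      rw [Finset.sum_congr rfl hterm, ← Finset.mul_sum, ← Finset.mul_sum, sum_pow_rank]
      have : (Finset.univ.filter fun β => s β = 1).card = n + 1 := hs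
      rw [this, Finset.mul_sum, qFact, qFact, Finset.prod_range_succ, ← sum_exp_eq_qInt h (n + 1)]
      rw [mul_right_comm]
      congr 2
      refine Finset.sum_congr rfl fun i _ => ?_
      rw [← Complex.exp_nat_mul, ← Complex.exp_add]
      congr 1; push_cast; ring
    · refine Finset.sum_eq_zero fun k hk => ?_
      have hk1 : s k = 1 := by simpa using hk
      have hc := downCount_update hk1
      rw [ih, if_neg (by omega), mul_zero]

theorem qFact_ne_zero {q : ℂ} {ℓ n : ℕ} (hq : ∀ n : ℕ, 1 ≤ n → n ≤ ℓ → qInt q n ≠ 0)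
    (hn : n ≤ ℓ) : qFact q n ≠ 0 :=
  Finset.prod_ne_zero_iff.2 fun k hk => hq _ (by omega) (by have := Finset.mem_range.1 hk; omega)

theorem ket_apply {η : ℂ} {ℓ n : ℕ}
    (hq : ∀ n : ℕ, 1 ≤ n → n ≤ ℓ → qInt (Complex.exp η) n ≠ 0) (hℓ : 1 ≤ ℓ) (hn : n ≤ ℓ)
    (s : Config ℓ) :
    ket (Complex.exp η) ℓ n s = if downCount s = n then
      Complex.exp (η * (tilt s - n * ((ℓ : ℂ) - n) / 2)) else 0 := by
  rw [ket, Pi.smul_apply, deltaXMinus_pow_vac (hq 1 le_rfl hℓ), smul_eq_mul, mul_ite, mul_zero,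
    inv_mul_cancel_left₀ (qFact_ne_zero hq hn)]

/-! ### The Gaussian binomial sum -/

/-- The sum of `q ^ (2 tilt s)` over the configurations with `n` down spins. -/
def tiltSum (η : ℂ) (ℓ n : ℕ) : ℂ := ∑ s ∈ seqs ℓ n, Complex.exp (2 * η * tilt s)

theorem downCount_cons {ℓ : ℕ} (c : Fin 2) (s : Config ℓ) :
    downCount (Fin.cons c s : Config (ℓ + 1)) = (if c = 1 then 1 else 0) + downCount s := by
  simp only [downCount, Finset.card_filter, Fin.sum_univ_succ, Fin.cons_zero, Fin.cons_succ]

/-- Prepending a site moves the old positions by one and the centre by one half, so each old down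
spin gains one half. The new site sits at `-ℓ / 2`. -/
theorem tilt_cons {ℓ : ℕ} (c : Fin 2) (s : Config ℓ) :
    tilt (Fin.cons c s : Config (ℓ + 1)) =
      (if c = 1 then -(ℓ : ℂ) / 2 else 0) + tilt s + downCount s / 2 := by
  have : (downCount s : ℂ) / 2 = ∑ β, if s β = 1 then (1 / 2 : ℂ) else 0 := by
    rw [downCount, Finset.card_filter]
    push_cast
    rw [Finset.sum_div]
    refine Finset.sum_congr rfl fun β _ => ?_
    split_ifs <;> simp
  rw [tilt, Fin.sum_univ_succ, this, add_assoc, tilt, ← Finset.sum_add_distrib]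
  simp only [Fin.cons_zero, Fin.cons_succ]
  congr 1
  · split_ifs
    · simp; ring
    · rfl
  · refine Finset.sum_congr rfl fun β _ => ?_
    split_ifs
    · push_cast [Fin.val_succ]; ring
    · simp

theorem tiltSum_eq_sum_ite (η : ℂ) (ℓ n : ℕ) : tiltSum η ℓ n =
    ∑ s : Config ℓ, if downCount s = n then Complex.exp (2 * η * tilt s) else 0 := by
  rw [tiltSum, ← Finset.sum_filter]
  refine Finset.sum_congr ?_ fun _ _ => rfl
  ext s; simp [mem_seqs]

/-- The q-Pascal recursion, obtained by splitting according to the first spin. -/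
theorem tiltSum_succ (η : ℂ) (ℓ n : ℕ) :
    tiltSum η (ℓ + 1) n = Complex.exp (η * n) * tiltSum η ℓ n +
      if 1 ≤ n then Complex.exp (η * (n - 1 - ℓ)) * tiltSum η ℓ (n - 1) else 0 := by
  simp only [tiltSum_eq_sum_ite]
  rw [← (Fin.consEquiv fun _ => Fin 2).sum_comp, Fintype.sum_prod_type,
    Fin.sum_univ_two, Finset.mul_sum]
  simp only [Fin.consEquiv, Equiv.coe_fn_mk, downCount_cons, tilt_cons]
  congr 1
  · refine Finset.sum_congr rfl fun s _ => ?_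
    by_cases h : downCount s = n
    · subst h
      simp only [zero_ne_one, if_false, if_true, zero_add, ← Complex.exp_add]
      congr 1; ring
    · simp [h]
  · simp only [if_true]
    by_cases h1 : 1 ≤ n
    · rw [if_pos h1, Finset.mul_sum]
      refine Finset.sum_congr rfl fun s _ => ?_
      by_cases h : downCount s = n - 1
      · rw [if_pos h, if_pos (by omega), ← Complex.exp_add, h, Nat.cast_sub h1]
        congr 1; push_cast; ring
      · rw [if_neg h, if_neg (by omega), mul_zero]
    · rw [if_neg h1]
      refine Finset.sum_eq_zero fun s _ => ?_
      rw [if_neg (by omega)]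

theorem downCount_le {ℓ : ℕ} (s : Config ℓ) : downCount s ≤ ℓ := by
  simpa [downCount] using Finset.card_filter_le (Finset.univ : Finset (Fin ℓ)) fun β => s β = 1

theorem tiltSum_eq_zero (η : ℂ) {ℓ n : ℕ} (h : ℓ < n) : tiltSum η ℓ n = 0 := by
  refine Finset.sum_eq_zero fun s hs => ?_
  have := downCount_le s
  rw [mem_seqs] at hs; omega

theorem qInt_add (η : ℂ) (a b : ℕ) :
    Complex.exp (η * a) * qInt (Complex.exp η) b + Complex.exp (-(η * b)) * qInt (Complex.exp η) a =
      qInt (Complex.exp η) (a + b) := by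
  rw [qInt, qInt, qInt, mul_div_assoc', mul_div_assoc', ← add_div, Complex.exp_neg,
    mul_comm η, mul_comm η, Complex.exp_nat_mul, Complex.exp_nat_mul, pow_add]
  have h0 := Complex.exp_ne_zero η
  congr 1
  field_simp
  ring

theorem qFact_succ (q : ℂ) (n : ℕ) : qFact q (n + 1) = qFact q n * qInt q (n + 1) :=
  Finset.prod_range_succ _ _

/-- The q-Pascal recursion together with `qInt_add` is the induction step. The multiplied-out form
avoids division, so no nonvanishing of q-integers is needed. -/
theorem tiltSum_mul_qFact (η : ℂ) {ℓ n : ℕ} (hn : n ≤ ℓ) :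
    tiltSum η ℓ n * (qFact (Complex.exp η) (ℓ - n) * qFact (Complex.exp η) n) =
      qFact (Complex.exp η) ℓ := by
  induction ℓ generalizing n with
  | zero =>
    obtain rfl : n = 0 := by omega
    have : seqs 0 0 = Finset.univ := by
      ext s; simp only [mem_seqs, Finset.mem_univ, iff_true]; simp [downCount]
    rw [tiltSum, this, Fintype.sum_subsingleton _ fun _ => 0]
    simp [tilt, qFact]
  | succ ℓ ih =>
    rw [tiltSum_succ]
    rcases n with _ | n
    · have := ih (Nat.zero_le ℓ)
      simp only [Nat.sub_zero, qFact_succ] at this ⊢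
      simp only [Nat.cast_zero, mul_zero, Complex.exp_zero]
      rw [if_neg (by omega)]
      linear_combination qInt (Complex.exp η) (ℓ + 1) * this
    · rw [if_pos (by omega), Nat.add_sub_cancel, Nat.add_sub_add_right]
      have h1 := ih (n := n) (by omega)
      obtain h | h := Nat.lt_or_ge ℓ (n + 1)
      -- At the upper boundary every spin is down, and only the second Pascal term survives.
      · obtain rfl : n = ℓ := by omega
        rw [tiltSum_eq_zero η h, qFact_succ]
        simp only [Nat.cast_add, Nat.cast_one, add_sub_cancel_right, sub_self, mul_zero,
          Complex.exp_zero, one_mul, zero_add]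
        linear_combination qInt (Complex.exp η) (n + 1) * h1
      · obtain ⟨d, rfl⟩ := Nat.exists_eq_add_of_le h
        have h2 := ih h
        have e1 : n + 1 + d - n = d + 1 := by omega
        have e2 : n + 1 + d - (n + 1) = d := by omega
        rw [e2] at h2
        rw [e1] at h1 ⊢
        have h3 := qInt_add η (n + 1) (d + 1)
        have e3 : η * (((n + 1 : ℕ) : ℂ) - 1 - ((n + 1 + d : ℕ) : ℂ)) =
          -(η * ((d + 1 : ℕ) : ℂ)) := by push_cast; ring
        rw [qFact_succ _ (n + 1 + d), show n + 1 + d + 1 = n + 1 + (d + 1) by ring, ← h3, e3,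
          mul_add, mul_left_comm, mul_left_comm _ (Complex.exp (-_))]
        nth_rw 1 [← h2]
        rw [← h1, qFact_succ _ d, qFact_succ _ n]
        ring

theorem tiltSum_ne_zero {η : ℂ} {ℓ n : ℕ}
    (hq : ∀ n : ℕ, 1 ≤ n → n ≤ ℓ → qInt (Complex.exp η) n ≠ 0) (hn : n ≤ ℓ) :
    tiltSum η ℓ n ≠ 0 := by
  have := qFact_ne_zero hq le_rfl
  rw [← tiltSum_mul_qFact η hn] at this
  exact left_ne_zero_of_mul this

theorem qBinom_eq_tiltSum {η : ℂ} {ℓ n : ℕ}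
    (hq : ∀ n : ℕ, 1 ≤ n → n ≤ ℓ → qInt (Complex.exp η) n ≠ 0) (hn : n ≤ ℓ) :
    qBinom (Complex.exp η) ℓ n = tiltSum η ℓ n := by
  rw [qBinom, div_eq_iff (mul_ne_zero (qFact_ne_zero hq (Nat.sub_le _ _)) (qFact_ne_zero hq hn)),
    tiltSum_mul_qFact η hn]

theorem sqLength_eq {η : ℂ} {ℓ n : ℕ}
    (hq : ∀ n : ℕ, 1 ≤ n → n ≤ ℓ → qInt (Complex.exp η) n ≠ 0) (hℓ : 1 ≤ ℓ) (hn : n ≤ ℓ) :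
    sqLength (Complex.exp η) ℓ n = Complex.exp (-(η * (n * ((ℓ : ℂ) - n)))) * tiltSum η ℓ n := by
  rw [sqLength, dotProduct, tiltSum_eq_sum_ite, Finset.mul_sum]
  refine Finset.sum_congr rfl fun s _ => ?_
  rw [ket_apply hq hℓ hn]
  split_ifs
  · rw [← Complex.exp_add, ← Complex.exp_add]; congr 1; ring
  · simp

/-- Source of the exponent in `normHat`: the two amplitudes carry `-i(ℓ-i)/2` and `-j(ℓ-j)/2`, and
dividing by the square length adds `j(ℓ-j)`. -/
theorem vecMulVec_ket_bra {η : ℂ} {ℓ i j : ℕ}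
    (hq : ∀ n : ℕ, 1 ≤ n → n ≤ ℓ → qInt (Complex.exp η) n ≠ 0) (hℓ : 1 ≤ ℓ)
    (hi : i ≤ ℓ) (hj : j ≤ ℓ) (s t : Config ℓ) :
    vecMulVec (ket (Complex.exp η) ℓ i) (bra (Complex.exp η) ℓ j) s t =
      if downCount s = i ∧ downCount t = j then
        Complex.exp (η * (-(i * ((ℓ : ℂ) - i)) / 2 + j * ((ℓ : ℂ) - j) / 2)) / tiltSum η ℓ j *
          Complex.exp (η * (tilt s + tilt t)) else 0 := by
  rw [vecMulVec_apply, bra, Pi.smul_apply, ket_apply hq hℓ hi, ket_apply hq hℓ hj,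
    sqLength_eq hq hℓ hj]
  by_cases h1 : downCount s = i
  · by_cases h2 : downCount t = j
    · simp only [h1, h2, and_self, if_true, smul_eq_mul, mul_inv, ← Complex.exp_neg]
      rw [div_mul_eq_mul_div, ← Complex.exp_add, mul_right_comm, ← Complex.exp_add, ← mul_assoc,
        ← Complex.exp_add, div_eq_mul_inv]
      congr 2; ring
    · simp [h2]
  · simp [h1]

/-! ### Row vectors acted on by local operators -/

theorem sum_ite_eq_off {L : ℕ} (k : Fin L) (t : Config L) (F : Config L → ℂ) :
    (∑ s, if ∀ j, j ≠ k → s j = t j then F s else 0) = ∑ c, F (Function.update t k c) := by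
  symm
  refine Fintype.sum_of_injective (fun c => Function.update t k c)
    (Function.update_injective t k) _ _ ?_ ?_
  · intro s hs
    rw [if_neg]
    intro h
    exact hs ⟨s k, by
      funext j
      by_cases hj : j = k
      · subst hj; simp
      · simp [hj, h j hj]⟩
  · intro c
    rw [if_pos]
    intro j hj
    simp [hj]

theorem vecMul_rOp {L : ℕ} (w : Grading) (η u : ℂ) (k : Fin L) (U : Fin 2 × Config L → ℂ)
    (b : Fin 2) (t : Config L) :
    (U ᵥ* rOp w η u k) (b, t) =
      ∑ a, ∑ c, U (a, Function.update t k c) * rMatrix w η u (a, c) (b, t k) := by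
  simp only [vecMul, dotProduct, rOp, mul_ite, mul_zero]
  rw [Fintype.sum_prod_type]
  refine Finset.sum_congr rfl fun a _ => ?_
  rw [sum_ite_eq_off k t fun s => U (a, s) * rMatrix w η u (a, s k) (b, t k)]
  simp

/-- A row vector is invariant under the permutation `σ` of the sites. -/
def SiteInvariant {L : ℕ} (σ : Equiv.Perm (Fin L)) (U : Fin 2 × Config L → ℂ) : Prop :=
  ∀ a s, U (a, s ∘ σ) = U (a, s)

/-- The operators preserving invariance of row vectors under a permutation of the sites. -/
def invariancePreserving {L : ℕ} (σ : Equiv.Perm (Fin L)) : Submonoid (AuxOp L) where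
  carrier := {A | ∀ U, SiteInvariant σ U → SiteInvariant σ (U ᵥ* A)}
  one_mem' := fun U hU => by simpa using hU
  mul_mem' := fun {A B} hA hB U hU => by
    rw [← vecMul_vecMul]; exact hB _ (hA _ hU)

theorem rOp_mem_invariancePreserving {L : ℕ} (w : Grading) (η u : ℂ) {σ : Equiv.Perm (Fin L)}
    {k : Fin L} (hk : σ k = k) : rOp w η u k ∈ invariancePreserving σ := by
  intro U hU b t
  rw [vecMul_rOp, vecMul_rOp]
  refine Finset.sum_congr rfl fun a _ => Finset.sum_congr rfl fun c _ => ?_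
  have : Function.update (t ∘ σ) k c = Function.update t k c ∘ σ := by
    funext j
    by_cases hj : j = k
    · subst hj; simp [hk]
    · have : σ j ≠ k := fun h => hj (σ.injective (h.trans hk.symm))
      simp [hj, this]
  rw [this, hU, Function.comp_apply, hk]

/-- With `y` and `y + 2η` seen as `(y + η) ∓ η`, this is a difference-of-squares identity. It is the
relation between R-matrix entries that makes fusion work. -/
theorem sinh_exchange (y η : ℂ) :
    Complex.sinh (y + η) ^ 2 - Complex.sinh η ^ 2 = Complex.sinh (y + 2 * η) * Complex.sinh y := by
  rw [show y + 2 * η = (y + η) + η by ring, Complex.sinh_add (y + η) η]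
  have hy : Complex.sinh y = Complex.sinh (y + η) * Complex.cosh η -
      Complex.cosh (y + η) * Complex.sinh η := by
    rw [← Complex.sinh_sub]; congr 1; ring
  rw [hy]
  have h1 := Complex.cosh_sq (y + η)
  have h2 := Complex.cosh_sq η
  linear_combination Complex.sinh η ^ 2 * h1 - Complex.sinh (y + η) ^ 2 * h2

/-- The heart of fusion, in the form needed for row vectors. The principal grading matters: its two
off-diagonal entries are equal, so the invariance is under the plain swap of sites, without
q-weights. -/
theorem rOp_mul_rOp_mem_invariancePreserving {L : ℕ} {η y : ℂ} {k k' : Fin L} (hk : k ≠ k')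
    (h1 : Complex.sinh (y + η) ≠ 0) (h2 : Complex.sinh (y + 2 * η) ≠ 0) :
    rOp .principal η (y + η) k' * rOp .principal η y k ∈
      invariancePreserving (Equiv.swap k k') := by
  intro U hU b t
  rw [← vecMul_vecMul]
  simp only [vecMul_rOp, Function.update_of_ne hk.symm]
  have hswap : ∀ a c c', U (a, Function.update (Function.update (t ∘ Equiv.swap k k') k c) k' c') =
      U (a, Function.update (Function.update t k c') k' c) := by
    intro a c c'
    rw [← hU]
    congr 2
    funext j
    by_cases hj : j = k
    · subst hj; simp [hk]
    · by_cases hj' : j = k'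
      · subst hj'; simp [hk]
      · simp [hj, hj', Equiv.swap_apply_of_ne_of_ne]
  have hsym : ∀ a c c', U (a, Function.update (Function.update t k c) k' c') =
      U (a, Function.update (Function.update t k c') k' c) := by
    intro a c c'
    rw [← hU]
    congr 2
    funext j
    by_cases hj : j = k
    · subst hj; simp [hk]
    · by_cases hj' : j = k'
      · subst hj'; simp [hk]
      · simp [hj, hj', Equiv.swap_apply_of_ne_of_ne]
  simp only [hswap, Function.comp_apply, Equiv.swap_apply_left, Equiv.swap_apply_right]
  generalize t k = x
  generalize t k' = x'
  have h01 : ∀ a, U (a, Function.update (Function.update t k 0) k' 1) =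
      U (a, Function.update (Function.update t k 1) k' 0) := fun a => hsym a 0 1
  -- Write `b`, `c` for the R-matrix entries. The only relations required are `b(y+η) = b(y) +
  -- c(y+η) c(y)` and `c(y+η) = b(y+η) c(y)`.
  have hb : Complex.sinh (y + η) / Complex.sinh (y + 2 * η) =
      Complex.sinh y / Complex.sinh (y + η) + Complex.sinh η / Complex.sinh (y + 2 * η) *
        (Complex.sinh η / Complex.sinh (y + η)) := by
    have hs := sinh_exchange y η
    rw [div_mul_div_comm, div_add_div _ _ h1 (mul_ne_zero h2 h1), div_eq_div_iff h2 (mul_ne_zero h1 (mul_ne_zero h2 h1))]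
    linear_combination Complex.sinh (y + 2 * η) * Complex.sinh (y + η) * hs
  have hc : Complex.sinh η / Complex.sinh (y + 2 * η) =
      Complex.sinh (y + η) / Complex.sinh (y + 2 * η) *
        (Complex.sinh η / Complex.sinh (y + η)) := by
    field_simp
  have e : y + η + η = y + 2 * η := by ring
  simp only [Fin.sum_univ_two, h01]
  -- Equal spins at the two sites give nothing to prove; the four remaining cases have opposite
  -- spins.
  fin_cases b <;> fin_cases x <;> fin_cases x' <;> simp [rMatrix, Grading.sgn, e]
  · linear_combination -U (0, Function.update (Function.update t k 1) k' 0) * hb -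
      U (1, Function.update (Function.update t k 0) k' 0) * hc
  · linear_combination U (0, Function.update (Function.update t k 1) k' 0) * hb +
      U (1, Function.update (Function.update t k 0) k' 0) * hc
  · linear_combination U (0, Function.update (Function.update t k 1) k' 1) * hc +
      U (1, Function.update (Function.update t k 1) k' 0) * hb
  · linear_combination -U (0, Function.update (Function.update t k 1) k' 1) * hc -
      U (1, Function.update (Function.update t k 1) k' 0) * hb

/-- The factors `k` and `k + 1` need not lie in `H` separately; they are adjacent in the product and
enter as a pair. -/
theorem reverse_ofFn_prod_mem {M : Type*} [Monoid M] (H : Submonoid M) {n : ℕ} (f : Fin n → M)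
    (k : ℕ) (hk : k + 1 < n) (hf : ∀ j : Fin n, (j : ℕ) ≠ k → (j : ℕ) ≠ k + 1 → f j ∈ H)
    (hkk : f ⟨k + 1, hk⟩ * f ⟨k, by omega⟩ ∈ H) : (List.ofFn f).reverse.prod ∈ H := by
  induction n generalizing k with
  | zero => omega
  | succ n ih =>
    rw [List.ofFn_succ, List.reverse_cons, List.prod_append, List.prod_singleton]
    rcases k with _ | k
    · obtain ⟨m, rfl⟩ : ∃ m, n = m + 1 := ⟨n - 1, by omega⟩
      rw [List.ofFn_succ, List.reverse_cons, List.prod_append, List.prod_singleton, mul_assoc]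
      refine H.mul_mem (H.list_prod_mem ?_) hkk
      intro x hx
      obtain ⟨j, rfl⟩ := (List.mem_ofFn' _ _).1 (List.mem_reverse.1 hx)
      exact hf _ (by simp) (by simp)
    · refine H.mul_mem (ih _ k (by omega) (fun j h1 h2 => hf _ ?_ ?_) hkk) (hf _ ?_ ?_) <;>
        simp <;> omega

/-! ### Symmetry of row vectors inside the blocks -/

/-- The configuration `t` with its block `b` replaced by `c`. -/
def setBlock {Ns ℓ : ℕ} (b : Fin Ns) (c : Config ℓ) (t : Config (Ns * ℓ)) : Config (Ns * ℓ) :=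
  fun j => if (finProdFinEquiv.symm j).1 = b then c (finProdFinEquiv.symm j).2 else t j

/-- The restriction of a configuration to block `b`. -/
def getBlock {Ns ℓ : ℕ} (b : Fin Ns) (s : Config (Ns * ℓ)) : Config ℓ := fun β => s (site b β)

theorem setBlock_site {Ns ℓ : ℕ} (b b' : Fin Ns) (c : Config ℓ) (t : Config (Ns * ℓ))
    (β : Fin ℓ) : setBlock b c t (site b' β) = if b' = b then c β else t (site b' β) := by
  simp [setBlock, site]

theorem config_ext {Ns ℓ : ℕ} {s t : Config (Ns * ℓ)}
    (h : ∀ b β, s (site b β) = t (site b β)) : s = t := by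
  funext j
  obtain ⟨⟨b, β⟩, rfl⟩ := finProdFinEquiv.surjective j
  exact h b β

@[simp] theorem getBlock_setBlock {Ns ℓ : ℕ} (b : Fin Ns) (c : Config ℓ) (t : Config (Ns * ℓ)) :
    getBlock b (setBlock b c t) = c := by
  funext β; simp [getBlock, setBlock_site]

theorem getBlock_setBlock_of_ne {Ns ℓ : ℕ} {b b' : Fin Ns} (h : b' ≠ b) (c : Config ℓ)
    (t : Config (Ns * ℓ)) : getBlock b' (setBlock b c t) = getBlock b' t := by
  funext β; simp [getBlock, setBlock_site, h]

@[simp] theorem setBlock_getBlock {Ns ℓ : ℕ} (b : Fin Ns) (t : Config (Ns * ℓ)) :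
    setBlock b (getBlock b t) t = t := by
  refine config_ext fun b' β => ?_
  rw [setBlock_site]
  split_ifs with h
  · rw [h]; rfl
  · rfl

@[simp] theorem setBlock_setBlock {Ns ℓ : ℕ} (b : Fin Ns) (c c' : Config ℓ)
    (t : Config (Ns * ℓ)) : setBlock b c (setBlock b c' t) = setBlock b c t := by
  refine config_ext fun b' β => ?_
  simp only [setBlock_site]
  split_ifs <;> rfl

theorem setBlock_comm {Ns ℓ : ℕ} {b b' : Fin Ns} (h : b ≠ b') (c c' : Config ℓ)
    (t : Config (Ns * ℓ)) :
    setBlock b c (setBlock b' c' t) = setBlock b' c' (setBlock b c t) := by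
  refine config_ext fun d β => ?_
  simp only [setBlock_site]
  split_ifs with h1 h2
  · exact absurd (h1.symm.trans h2) h
  all_goals rfl

theorem setBlock_comp_swap {Ns ℓ : ℕ} (b : Fin Ns) (i j : Fin ℓ) (c : Config ℓ)
    (t : Config (Ns * ℓ)) :
    setBlock b c t ∘ Equiv.swap (site b i) (site b j) = setBlock b (c ∘ Equiv.swap i j) t := by
  refine config_ext fun d β => ?_
  by_cases hd : d = b
  · subst hd
    have : Equiv.swap (site d i) (site d j) (site d β) = site d (Equiv.swap i j β) := by
      have hinj : Function.Injective (site d : Fin ℓ → _) := fun x y hxy => by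
        simpa [site] using hxy
      exact (hinj.map_swap _ _ _).symm
    simp [this, setBlock_site]
  · rw [Function.comp_apply, Equiv.swap_apply_of_ne_of_ne, setBlock_site, setBlock_site, if_neg hd,
      if_neg hd]
    · intro h; exact hd (congrArg Prod.fst (finProdFinEquiv.injective h))
    · intro h; exact hd (congrArg Prod.fst (finProdFinEquiv.injective h))

/-- The value of `u` depends on block `b` only through its number of down spins. -/
def BlockSymmetric {Ns ℓ : ℕ} (b : Fin Ns) (u : Config (Ns * ℓ) → ℂ) : Prop :=
  ∀ t (c c' : Config ℓ), downCount c = downCount c' → u (setBlock b c t) = u (setBlock b c' t)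

theorem downCount_comp_perm {ℓ : ℕ} (c : Config ℓ) (π : Equiv.Perm (Fin ℓ)) :
    downCount (fun β => c (π β)) = downCount c := by
  rw [downCount, downCount, Finset.card_filter, Finset.card_filter]
  exact Equiv.sum_comp π fun β => if c β = 1 then 1 else 0

/-- A bijection between the two sets of down spins extends to a permutation of all sites; off these
sets both values are forced to be `0`. -/
theorem exists_perm_of_downCount_eq {ℓ : ℕ} {c c' : Config ℓ} (h : downCount c = downCount c') :
    ∃ π : Equiv.Perm (Fin ℓ), c = c' ∘ π := by
  have hcard : Fintype.card {β // c β = 1} = Fintype.card {β // c' β = 1} := by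
    rw [Fintype.card_subtype, Fintype.card_subtype]; exact h
  let e := Fintype.equivOfCardEq hcard
  refine ⟨e.extendSubtype, funext fun β => ?_⟩
  by_cases hβ : c β = 1
  · rw [hβ, Function.comp_apply, e.extendSubtype_mem β hβ]
  · have := e.extendSubtype_not_mem β hβ
    rw [Function.comp_apply]
    omega

/-- Adjacent transpositions generate the symmetric group, so only neighbouring sites need checking,
where the string condition applies. -/
theorem BlockSymmetric.of_swap {Ns ℓ : ℕ} {b : Fin Ns} {u : Config (Ns * ℓ) → ℂ}
    (h : ∀ (i : ℕ) (hi : i + 1 < ℓ) (s : Config (Ns * ℓ)),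
      u (s ∘ Equiv.swap (site b ⟨i, by omega⟩) (site b ⟨i + 1, hi⟩)) = u s) :
    BlockSymmetric b u := by
  intro t c c' hc
  obtain ⟨π, rfl⟩ := exists_perm_of_downCount_eq hc
  clear hc
  rcases ℓ with _ | ℓ
  · congr 2; exact Subsingleton.elim _ _
  have hπ : π ∈ Submonoid.closure
      (Set.range fun i : Fin ℓ => Equiv.swap i.castSucc i.succ) := by
    rw [Equiv.Perm.mclosure_swap_castSucc_succ]; trivial
  induction hπ using Submonoid.closure_induction generalizing c' with
  | mem x hx =>
    obtain ⟨i, rfl⟩ := hx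
    rw [← setBlock_comp_swap]
    exact h i (by omega) _
  | one => rfl
  | mul x y _ _ hx hy =>
    rw [Equiv.Perm.coe_mul, ← Function.comp_assoc, hy, hx]

theorem BlockSymmetric.swap {Ns ℓ : ℕ} {b : Fin Ns} {u : Config (Ns * ℓ) → ℂ}
    (h : BlockSymmetric b u) (i j : Fin ℓ) (s : Config (Ns * ℓ)) :
    u (s ∘ Equiv.swap (site b i) (site b j)) = u s := by
  conv_lhs => rw [← setBlock_getBlock b s, setBlock_comp_swap]
  conv_rhs => rw [← setBlock_getBlock b s]
  exact h _ _ _ (downCount_comp_perm _ _)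

/-! ### The monodromy matrix at the strings preserves block symmetry. -/

theorem sinh_ne_zero_of_isRegularParam {Ns ℓ : ℕ} {η : ℂ} {ξ : Fin Ns → ℂ} {x : ℂ}
    (hx : IsRegularParam ℓ η ξ x) (k : Fin (Ns * ℓ)) :
    Complex.sinh (x - stringParam ℓ η ξ k + η) ≠ 0 := by
  intro h
  have h' : Complex.sin ((x - stringParam ℓ η ξ k + η) * Complex.I) = 0 := by
    rw [Complex.sin_mul_I, h, zero_mul]
  obtain ⟨n, hn⟩ := Complex.sin_eq_zero_iff.1 h'
  -- From `z * I = n * π` follows `z = -n * π * I`, hence the sign.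
  apply hx k (-n)
  push_cast
  linear_combination -Complex.I * hn + (x - stringParam ℓ η ξ k + η) * Complex.I_mul_I

theorem stringParam_site {Ns ℓ : ℕ} (η : ℂ) (ξ : Fin Ns → ℂ) (b : Fin Ns) (β : Fin ℓ) :
    stringParam ℓ η ξ (site b β) = ξ b - ((β : ℕ) : ℂ) * η := by
  have h := finProdFinEquiv.symm_apply_apply (b, β)
  rw [finProdFinEquiv_symm_apply, Prod.mk.injEq] at h
  rw [stringParam, site, h.1, h.2]

theorem stringMonodromy_mem_invariancePreserving {Ns ℓ : ℕ} {η : ℂ} {ξ : Fin Ns → ℂ} {x : ℂ}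
    (hx : IsRegularParam ℓ η ξ x) (b : Fin Ns) {i : ℕ} (hi : i + 1 < ℓ) :
    stringMonodromy ℓ .principal η ξ x ∈
      invariancePreserving (Equiv.swap (site b ⟨i, by omega⟩) (site b ⟨i + 1, hi⟩)) := by
  set k : Fin (Ns * ℓ) := site b ⟨i, by omega⟩ with hk
  set k' : Fin (Ns * ℓ) := site b ⟨i + 1, hi⟩ with hk'
  have hkv : (k : ℕ) = i + ℓ * b := by simp [hk, site]
  have hkv' : (k' : ℕ) = (k : ℕ) + 1 := by rw [hkv]; simp [hk', site]; ring
  have hne : k ≠ k' := fun h => by rw [h] at hkv'; omega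
  have h1 := sinh_ne_zero_of_isRegularParam hx k
  have h2 := sinh_ne_zero_of_isRegularParam hx k'
  have e : x - stringParam ℓ η ξ k' = x - stringParam ℓ η ξ k + η := by
    rw [hk, hk', stringParam_site, stringParam_site]; push_cast; ring
  refine reverse_ofFn_prod_mem _ _ k (by rw [← hkv']; exact k'.2) (fun j h1 h2 => ?_) ?_
  · refine rOp_mem_invariancePreserving _ _ _ (Equiv.swap_apply_of_ne_of_ne ?_ ?_)
    · rintro rfl; exact h1 rfl
    · rintro rfl; exact h2 hkv'
  · have e' : (⟨(k : ℕ) + 1, by rw [← hkv']; exact k'.2⟩ : Fin (Ns * ℓ)) = k' := Fin.ext hkv'.symm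
    rw [e']
    simp only [Fin.eta]
    rw [e] at h2 ⊢
    refine rOp_mul_rOp_mem_invariancePreserving hne h1 ?_
    rwa [two_mul, ← add_assoc]

/-- Padding `u` by zero in the other auxiliary component transfers invariance from the full
monodromy matrix to its entries. -/
theorem vecMul_auxEntry {L : ℕ} (T : AuxOp L) (a b : Fin 2) (u : Config L → ℂ) (t : Config L) :
    (u ᵥ* auxEntry T a b) t = ((fun x : Fin 2 × Config L => if x.1 = a then u x.2 else 0) ᵥ* T)
      (b, t) := by
  simp only [vecMul, dotProduct, auxEntry]
  rw [Fintype.sum_prod_type, Finset.sum_eq_single a]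
  · simp
  · intro a' _ ha'; simp [ha']
  · simp

theorem BlockSymmetric.vecMul_auxEntry {Ns ℓ : ℕ} {η : ℂ} {ξ : Fin Ns → ℂ} {x : ℂ}
    (hx : IsRegularParam ℓ η ξ x) {b : Fin Ns} {u : Config (Ns * ℓ) → ℂ}
    (hu : BlockSymmetric b u) (a a' : Fin 2) :
    BlockSymmetric b (u ᵥ* auxEntry (stringMonodromy ℓ .principal η ξ x) a a') := by
  refine BlockSymmetric.of_swap fun i hi s => ?_
  rw [HigherSpinXXZ.vecMul_auxEntry, HigherSpinXXZ.vecMul_auxEntry]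
  refine stringMonodromy_mem_invariancePreserving hx b hi _ ?_ _ _
  intro c t
  simp only
  rw [hu.swap]

/-! ### Products over lists of operators -/

theorem prod_map_conj {M : Type*} [Monoid M] {K K' : M} (h : K * K' = 1) (h' : K' * K = 1)
    (l : List M) : (l.map fun x => K * x * K').prod = K * l.prod * K' := by
  induction l with
  | nil => simp [h]
  | cons x l ih =>
    rw [List.map_cons, List.prod_cons, ih, List.prod_cons]
    simp only [mul_assoc]
    rw [← mul_assoc K' K, h', one_mul]

theorem prod_ofFn_conj {M : Type*} [Monoid M] {K K' : M} (h : K * K' = 1) (h' : K' * K = 1)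
    {n : ℕ} (f : Fin n → M) :
    (List.ofFn fun i => K * f i * K').prod = K * (List.ofFn f).prod * K' := by
  rw [← prod_map_conj h h', List.map_ofFn]; rfl

theorem prod_ofFn_smul {ι : Type*} [Fintype ι] [DecidableEq ι] {n : ℕ} (c : Fin n → ℂ)
    (f : Fin n → Matrix ι ι ℂ) :
    (List.ofFn fun i => c i • f i).prod = (∏ i, c i) • (List.ofFn f).prod := by
  induction n with
  | zero => simp
  | succ n ih =>
    rw [List.ofFn_succ, List.prod_cons, ih fun i => c i.succ, List.ofFn_succ, List.prod_cons,
      Fin.prod_univ_succ, smul_mul_smul_comm]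

theorem prod_ofFn_diagonal {ι : Type*} [Fintype ι] [DecidableEq ι] {n : ℕ}
    (d : Fin n → ι → ℂ) :
    (List.ofFn fun i => Matrix.diagonal (d i)).prod = Matrix.diagonal (∏ i, d i) := by
  rw [← List.prod_ofFn]
  change _ = Matrix.diagonalRingHom ι ℂ _
  rw [map_list_prod, List.map_ofFn]
  rfl

theorem prod_ofFn_ite {M : Type*} [Monoid M] {n : ℕ} (f : Fin n → M) (k : Fin n) :
    (List.ofFn fun i => if k = i then f i else 1).prod = f k := by
  induction n with
  | zero => exact k.elim0
  | succ n ih =>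
    rw [List.ofFn_succ, List.prod_cons]
    refine Fin.cases ?_ (fun k => ?_) k
    · rw [if_pos rfl, List.prod_eq_one, mul_one]
      intro x hx
      obtain ⟨i, rfl⟩ := (List.mem_ofFn' _ _).1 hx
      exact if_neg (Fin.succ_ne_zero i).symm
    · rw [if_neg (Fin.succ_ne_zero k), one_mul]
      simp only [Fin.succ_inj]
      exact ih (fun i => f i.succ) k

theorem vecMul_list_prod_eq_self {ι : Type*} [Fintype ι] [DecidableEq ι] {u : ι → ℂ}
    {l : List (Matrix ι ι ℂ)} (h : ∀ X ∈ l, u ᵥ* X = u) : u ᵥ* l.prod = u := by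
  induction l with
  | nil => simp
  | cons X l ih =>
    rw [List.prod_cons, ← vecMul_vecMul, h X (by simp), ih fun Y hY => h Y (by simp [hY])]

/-! ### Diagonal gauge transformations -/

/-- The diagonal matrix with entries `exp (f s)`. -/
def expDiag {ι : Type*} [DecidableEq ι] (f : ι → ℂ) : Matrix ι ι ℂ :=
  Matrix.diagonal fun s => Complex.exp (f s)

section expDiag

variable {ι : Type*} [Fintype ι] [DecidableEq ι]

theorem expDiag_mul (f g : ι → ℂ) : expDiag f * expDiag g = expDiag (f + g) := by
  simp [expDiag, Complex.exp_add]

theorem expDiag_mul_neg (f : ι → ℂ) : expDiag f * expDiag (-f) = 1 := by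
  simp only [expDiag, Matrix.diagonal_mul_diagonal, ← Complex.exp_add, Pi.neg_apply,
    add_neg_cancel, Complex.exp_zero, Matrix.diagonal_one]

theorem expDiag_neg_mul (f : ι → ℂ) : expDiag (-f) * expDiag f = 1 := by
  simp only [expDiag, Matrix.diagonal_mul_diagonal, ← Complex.exp_add, Pi.neg_apply,
    neg_add_cancel, Complex.exp_zero, Matrix.diagonal_one]

theorem expDiag_inv (f : ι → ℂ) : (expDiag f)⁻¹ = expDiag (-f) :=
  Matrix.inv_eq_right_inv (expDiag_mul_neg f)

theorem expDiag_conj_apply (f g : ι → ℂ) (X : Matrix ι ι ℂ) (s t : ι) :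
    (expDiag f * X * expDiag g) s t = Complex.exp (f s) * X s t * Complex.exp (g t) := by
  simp [expDiag]

end expDiag

/-! ### Block operators and their gauge conjugation. -/

theorem vecMul_onBlock {Ns ℓ : ℕ} (b : Fin Ns) (X : Op ℓ) (u : Config (Ns * ℓ) → ℂ)
    (t : Config (Ns * ℓ)) :
    (u ᵥ* onBlock b X) t = ∑ c, u (setBlock b c t) * X c (getBlock b t) := by
  simp only [vecMul, dotProduct, onBlock, mul_ite, mul_zero]
  symm
  refine Fintype.sum_of_injective (fun c => setBlock b c t) ?_ _ _ ?_ ?_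
  · intro c c' h
    simpa using congrArg (getBlock b) h
  · intro s hs
    rw [if_neg]
    intro h
    refine hs ⟨getBlock b s, config_ext fun d β => ?_⟩
    simp only [setBlock_site]
    split_ifs with hd
    · rw [hd]; rfl
    · exact (h d β hd).symm
  · intro c
    rw [if_pos]
    · congr 2
      exact (getBlock_setBlock b c t).symm
    · intro d β hd
      rw [setBlock_site, if_neg hd]

theorem onBlock_diagonal {Ns ℓ : ℕ} (b : Fin Ns) (d : Config ℓ → ℂ) :
    onBlock b (Matrix.diagonal d) = Matrix.diagonal fun s => d (getBlock b s) := by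
  ext s t
  rw [onBlock, Matrix.diagonal_apply, Matrix.diagonal_apply]
  by_cases h : s = t
  · subst h; simp; rfl
  · rw [if_neg h]
    split_ifs with h1 h2
    · exfalso; apply h
      refine config_ext fun c β => ?_
      by_cases hc : c = b
      · rw [hc]; exact congrFun h2 β
      · exact h1 c β hc
    all_goals rfl

/-- A nonzero entry forces agreement outside block `b`, so the exponents of all other blocks cancel.
A global gauge can thus be checked one block at a time. -/
theorem onBlock_eq_conj {Ns ℓ : ℕ} {b : Fin Ns} {F : Fin Ns → Config ℓ → ℂ} {X Y : Op ℓ}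
    (h : ∀ c c', X c c' = Complex.exp (F b c - F b c') * Y c c') :
    onBlock b X = expDiag (fun s => ∑ d, F d (getBlock d s)) * onBlock b Y *
      expDiag (-fun s => ∑ d, F d (getBlock d s)) := by
  ext s t
  rw [expDiag_conj_apply, onBlock, onBlock]
  split_ifs with hst
  · rw [h, mul_right_comm, ← Complex.exp_add]
    congr 2
    have : ∑ d, F d (getBlock d s) - ∑ d, F d (getBlock d t) =
        F b (getBlock b s) - F b (getBlock b t) := by
      rw [← Finset.sum_sub_distrib, Finset.sum_eq_single b]
      · intro d _ hd
        rw [show getBlock d s = getBlock d t from funext fun β => hst d β hd, sub_self]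
      · simp
    rw [Pi.neg_apply, ← sub_eq_add_neg, this]
    rfl
  · simp

/-- The exponent contributed by one block to the gauge transformation from the symmetrised chain
in the principal grading to the chain in the grading `w`. -/
def blockGaugeExponent {Ns : ℕ} (ℓ : ℕ) (w : Grading) (η : ℂ) (ξ : Fin Ns → ℂ) (b : Fin Ns)
    (c : Config ℓ) : ℂ :=
  w.sgn * (downCount c * stringCenter ℓ η ξ b) - η * tilt c

/-- The exponent of the gauge transformation from the symmetrised chain in the principal grading
to the chain in the grading `w`. -/
def gaugeExponent {Ns : ℕ} (ℓ : ℕ) (w : Grading) (η : ℂ) (ξ : Fin Ns → ℂ) :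
    Config (Ns * ℓ) → ℂ :=
  fun s => ∑ b, blockGaugeExponent ℓ w η ξ b (getBlock b s)

/-- The exponent of the gauge transformation `χ^{(ℓ)}`. -/
def centerExponent {Ns : ℕ} (ℓ : ℕ) (η : ℂ) (ξ : Fin Ns → ℂ) : Config (Ns * ℓ) → ℂ :=
  fun s => ∑ b, downCount (getBlock b s) * stringCenter ℓ η ξ b

theorem gauge_eq_expDiag {Ns : ℕ} (ℓ : ℕ) (η : ℂ) (ξ : Fin Ns → ℂ) :
    gauge ℓ η ξ = expDiag (centerExponent ℓ η ξ) := by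
  simp only [gauge, phiBlock, onBlock_diagonal]
  rw [prod_ofFn_diagonal, expDiag]
  congr 1
  funext s
  rw [Finset.prod_apply, centerExponent, Complex.exp_sum]
  rfl

theorem gaugeExponent_eq {Ns : ℕ} (ℓ : ℕ) (w : Grading) (η : ℂ) (ξ : Fin Ns → ℂ) :
    gaugeExponent ℓ w η ξ =
      (fun s => w.sgn * centerExponent ℓ η ξ s) + gaugeExponent ℓ .principal η ξ := by
  funext s
  simp only [gaugeExponent, blockGaugeExponent, centerExponent, Pi.add_apply, Finset.mul_sum,
    Grading.sgn, ← Finset.sum_add_distrib]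
  refine Finset.sum_congr rfl fun b _ => ?_
  ring

/-- A down spin contributes the string centre minus `η` times its offset from the block centre,
which is precisely its inhomogeneity. This identifies the symmetrising gauge with the gauge between
gradings. -/
theorem gaugeExponent_plus {Ns : ℕ} (ℓ : ℕ) (η : ℂ) (ξ : Fin Ns → ℂ) (s : Config (Ns * ℓ)) :
    gaugeExponent ℓ .plus η ξ s = ∑ k, if s k = 1 then stringParam ℓ η ξ k else 0 := by
  rw [← finProdFinEquiv.sum_comp, Fintype.sum_prod_type, gaugeExponent]
  refine Finset.sum_congr rfl fun b _ => ?_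
  have hd : (downCount (getBlock b s) : ℂ) = ∑ β, if getBlock b s β = 1 then (1 : ℂ) else 0 := by
    rw [downCount, Finset.card_filter]; push_cast; rfl
  rw [blockGaugeExponent, hd, tilt, Finset.sum_mul, Finset.mul_sum, Finset.mul_sum,
    ← Finset.sum_sub_distrib]
  refine Finset.sum_congr rfl fun β _ => ?_
  have hs : s (finProdFinEquiv (b, β)) = getBlock b s β := rfl
  have hp : stringParam ℓ η ξ (finProdFinEquiv (b, β)) = ξ b - ((β : ℕ) : ℂ) * η :=
    stringParam_site η ξ b β
  rw [hs, hp]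
  split_ifs
  · simp only [Grading.sgn, stringCenter]; ring
  · simp

/-! ### The monodromy matrix in the three gradings -/

/-- Only an exchange of spins between the auxiliary space and site `k` changes the exponent, by `±(x
- v k)`. The exponent ranges over all sites so that one gauge serves every factor and telescopes. -/
theorem rOp_plus_eq_conj {L : ℕ} (η x : ℂ) (v : Fin L → ℂ) (k : Fin L) :
    rOp .plus η (x - v k) k =
      expDiag (fun y : Fin 2 × Config L =>
        (if y.1 = 1 then x else 0) + ∑ j, if y.2 j = 1 then v j else 0) *
      rOp .principal η (x - v k) k *
      expDiag (-fun y : Fin 2 × Config L =>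
        (if y.1 = 1 then x else 0) + ∑ j, if y.2 j = 1 then v j else 0) := by
  ext ⟨a, s⟩ ⟨b, t⟩
  rw [expDiag_conj_apply, rOp, rOp]
  by_cases h : ∀ j, j ≠ k → s j = t j
  · have hsum : (∑ j, if s j = 1 then v j else 0) - (∑ j, if t j = 1 then v j else 0) =
        (if s k = 1 then v k else 0) - if t k = 1 then v k else 0 := by
      rw [← Finset.sum_sub_distrib, Finset.sum_eq_single k]
      · intro j _ hj
        have : s j = t j := h j hj
        rw [this, sub_self]
      · simp
    rw [if_pos h, if_pos h, mul_right_comm, ← Complex.exp_add, Pi.neg_apply]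
    have e : ((if a = 1 then x else 0) + ∑ j, if s j = 1 then v j else 0) +
        -((if b = 1 then x else 0) + ∑ j, if t j = 1 then v j else 0) =
        ((if a = 1 then x else 0) - if b = 1 then x else 0) +
        ((if s k = 1 then v k else 0) - if t k = 1 then v k else 0) := by
      rw [← hsum]; ring
    simp only
    rw [e]
    generalize s k = p
    generalize t k = p'
    fin_cases a <;> fin_cases b <;> fin_cases p <;> fin_cases p' <;>
      simp [rMatrix, Grading.sgn, mul_div_assoc]
    · exact Or.inl (by congr 1; ring)
    · exact Or.inl (by congr 1)
  · rw [if_neg h, if_neg h, mul_zero, zero_mul]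

theorem monodromy_plus_eq_conj {L : ℕ} (η x : ℂ) (v : Fin L → ℂ) :
    monodromy .plus η v x =
      expDiag (fun y : Fin 2 × Config L =>
        (if y.1 = 1 then x else 0) + ∑ j, if y.2 j = 1 then v j else 0) *
      monodromy .principal η v x *
      expDiag (-fun y : Fin 2 × Config L =>
        (if y.1 = 1 then x else 0) + ∑ j, if y.2 j = 1 then v j else 0) := by
  rw [monodromy, monodromy, ← prod_map_conj (expDiag_mul_neg _) (expDiag_neg_mul _),
    List.map_reverse, List.map_ofFn]
  congr 3
  funext k
  exact rOp_plus_eq_conj η x v k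

theorem auxEntry_stringMonodromy_plus {Ns : ℕ} (ℓ : ℕ) (η : ℂ) (ξ : Fin Ns → ℂ) (x : ℂ)
    (a b : Fin 2) :
    auxEntry (stringMonodromy ℓ .plus η ξ x) a b =
      Complex.exp ((if a = 1 then x else 0) - if b = 1 then x else 0) •
        (expDiag (gaugeExponent ℓ .plus η ξ) *
          auxEntry (stringMonodromy ℓ .principal η ξ x) a b *
          expDiag (-gaugeExponent ℓ .plus η ξ)) := by
  ext s t
  rw [Matrix.smul_apply, expDiag_conj_apply, auxEntry, auxEntry, stringMonodromy,
    monodromy_plus_eq_conj, expDiag_conj_apply, smul_eq_mul, Pi.neg_apply, Pi.neg_apply,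
    gaugeExponent_plus, gaugeExponent_plus, stringMonodromy]
  simp only [sub_eq_add_neg, neg_add, Complex.exp_add]
  ring

/-! ### The fusion projector and the fused monodromy matrix in the symmetrising gauge. -/

/-- The projection operator in the symmetrising gauge: it averages over the configurations of a
block with the same number of down spins. -/
def symProj (η : ℂ) (ℓ : ℕ) : Op ℓ := fun c c' =>
  if downCount c = downCount c' then
    Complex.exp (2 * η * tilt c) / tiltSum η ℓ (downCount c') else 0

/-- The product of the operators `symProj` over the blocks. -/
def symProjAll (η : ℂ) (ℓ Ns : ℕ) : Op (Ns * ℓ) :=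
  (List.ofFn fun b : Fin Ns => onBlock b (symProj η ℓ)).prod

theorem proj_apply {η : ℂ} {ℓ : ℕ}
    (hq : ∀ n : ℕ, 1 ≤ n → n ≤ ℓ → qInt (Complex.exp η) n ≠ 0) (hℓ : 1 ≤ ℓ) (c c' : Config ℓ) :
    proj (Complex.exp η) ℓ c c' = if downCount c = downCount c' then
      Complex.exp (η * (tilt c + tilt c')) / tiltSum η ℓ (downCount c') else 0 := by
  rw [proj, Matrix.sum_apply, Finset.sum_eq_single (downCount c')]
  · rw [vecMulVec_ket_bra hq hℓ (downCount_le c') (downCount_le c')]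
    simp only [and_true]
    split_ifs
    · rw [neg_div, neg_add_cancel, mul_zero, Complex.exp_zero]; ring
    · rfl
  · intro n hn hne
    have hn' : n ≤ ℓ := by have := Finset.mem_range.1 hn; omega
    rw [vecMulVec_ket_bra hq hℓ hn' hn', if_neg]
    exact fun h => hne h.2.symm
  · intro h
    exact absurd (Finset.mem_range.2 (Nat.lt_succ_of_le (downCount_le c'))) h

/-- The grading is arbitrary because the projector preserves the down count of each block, so the
string-centre part of the exponent cancels. -/
theorem projAll_eq_conj {η : ℂ} {ℓ Ns : ℕ}
    (hq : ∀ n : ℕ, 1 ≤ n → n ≤ ℓ → qInt (Complex.exp η) n ≠ 0) (hℓ : 1 ≤ ℓ) (w : Grading)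
    (ξ : Fin Ns → ℂ) :
    projAll (Complex.exp η) ℓ Ns = expDiag (gaugeExponent ℓ w η ξ) * symProjAll η ℓ Ns *
      expDiag (-gaugeExponent ℓ w η ξ) := by
  rw [projAll, symProjAll, ← prod_ofFn_conj (expDiag_mul_neg _) (expDiag_neg_mul _)]
  congr 2
  funext b
  refine onBlock_eq_conj (F := blockGaugeExponent ℓ w η ξ) fun c c' => ?_
  rw [proj_apply hq hℓ, symProj]
  split_ifs with h
  · rw [mul_div_assoc', ← Complex.exp_add, blockGaugeExponent, blockGaugeExponent, h]
    congr 2; ring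
  · rw [mul_zero]

theorem auxEntry_kronecker_conj {L : ℕ} (P : Op L) (T : AuxOp L) (a b : Fin 2) :
    auxEntry (Matrix.kronecker (1 : Matrix (Fin 2) (Fin 2) ℂ) P * T *
      Matrix.kronecker (1 : Matrix (Fin 2) (Fin 2) ℂ) P) a b = P * auxEntry T a b * P := by
  ext s t
  simp only [auxEntry, Matrix.mul_apply, Fintype.sum_prod_type, Matrix.kronecker,
    Matrix.kroneckerMap_apply, Fin.sum_univ_two]
  obtain rfl | rfl : a = 0 ∨ a = 1 := by omega
  all_goals obtain rfl | rfl : b = 0 ∨ b = 1 := by omega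
  all_goals simp

theorem auxGauge_eq_expDiag {Ns : ℕ} (ℓ : ℕ) (η : ℂ) (ξ : Fin Ns → ℂ) (x : ℂ) :
    auxGauge ℓ η ξ x = expDiag fun y : Fin 2 × Config (Ns * ℓ) =>
      (if y.1 = 1 then x else 0) + centerExponent ℓ η ξ y.2 := by
  rw [auxGauge, gauge_eq_expDiag, phi, expDiag, Matrix.kronecker,
    Matrix.diagonal_kronecker_diagonal, expDiag]
  congr 1
  funext ⟨a, s⟩
  fin_cases a <;> simp [Complex.exp_add]

/-- For `+`, the projector and the spin-1/2 monodromy matrix share one gauge. Each further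
conjugation by `auxGauge` lowers `w.sgn` by one, in the exponent on the chain and in the auxiliary
factor alike. -/
theorem auxEntry_fusedMonodromy {Ns ℓ : ℕ} {η : ℂ}
    (hq : ∀ n : ℕ, 1 ≤ n → n ≤ ℓ → qInt (Complex.exp η) n ≠ 0) (hℓ : 1 ≤ ℓ) (w : Grading)
    (ξ : Fin Ns → ℂ) (x : ℂ) (a b : Fin 2) :
    auxEntry (fusedMonodromy ℓ w η ξ x) a b =
      Complex.exp (w.sgn * ((if a = 1 then x else 0) - if b = 1 then x else 0)) •
        (expDiag (gaugeExponent ℓ w η ξ) *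
          (symProjAll η ℓ Ns * auxEntry (stringMonodromy ℓ .principal η ξ x) a b *
            symProjAll η ℓ Ns) * expDiag (-gaugeExponent ℓ w η ξ)) := by
  have hplus : auxEntry (fusedMonodromy ℓ .plus η ξ x) a b =
      Complex.exp ((if a = 1 then x else 0) - if b = 1 then x else 0) •
        (expDiag (gaugeExponent ℓ .plus η ξ) *
          (symProjAll η ℓ Ns * auxEntry (stringMonodromy ℓ .principal η ξ x) a b *
            symProjAll η ℓ Ns) * expDiag (-gaugeExponent ℓ .plus η ξ)) := by
    simp only [fusedMonodromy]
    rw [auxEntry_kronecker_conj, auxEntry_stringMonodromy_plus, projAll_eq_conj hq hℓ .plus ξ,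
      Matrix.mul_smul, Matrix.smul_mul]
    congr 1
    have h := expDiag_neg_mul (gaugeExponent ℓ .plus η ξ)
    generalize expDiag (gaugeExponent ℓ .plus η ξ) = K at h ⊢
    generalize expDiag (-gaugeExponent ℓ .plus η ξ) = K' at h ⊢
    simp only [Matrix.mul_assoc]
    rw [← Matrix.mul_assoc K' K, h, Matrix.one_mul, ← Matrix.mul_assoc K' K, h, Matrix.one_mul]
  have hconj : ∀ (T : AuxOp (Ns * ℓ)) (s t : Config (Ns * ℓ)),
      ((auxGauge ℓ η ξ x)⁻¹ * T * auxGauge ℓ η ξ x) (a, s) (b, t) =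
        Complex.exp (-((if a = 1 then x else 0) + centerExponent ℓ η ξ s)) * T (a, s) (b, t) *
          Complex.exp ((if b = 1 then x else 0) + centerExponent ℓ η ξ t) := by
    intro T s t
    rw [auxGauge_eq_expDiag, expDiag_inv, expDiag_conj_apply]
    rfl
  ext s t
  have hst := congrFun (congrFun hplus s) t
  rw [Matrix.smul_apply, expDiag_conj_apply, Pi.neg_apply, smul_eq_mul,
    gaugeExponent_eq ℓ .plus] at hst
  simp only [fusedMonodromy, auxEntry, Grading.sgn, Pi.add_apply] at hst
  rw [Matrix.smul_apply, expDiag_conj_apply, Pi.neg_apply, smul_eq_mul, gaugeExponent_eq ℓ w]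
  generalize (symProjAll η ℓ Ns * auxEntry (stringMonodromy ℓ .principal η ξ x) a b *
    symProjAll η ℓ Ns) s t = z at hst ⊢
  have hexp : ∀ (p q r p' q' r' : ℂ), p + q + r = p' + q' + r' →
      Complex.exp p * (Complex.exp q * z * Complex.exp r) =
        Complex.exp p' * (Complex.exp q' * z * Complex.exp r') := by
    intro p q r p' q' r' h
    have : Complex.exp p * Complex.exp q * Complex.exp r =
      Complex.exp p' * Complex.exp q' * Complex.exp r' := by
      rw [← Complex.exp_add, ← Complex.exp_add, h, Complex.exp_add, Complex.exp_add]
    linear_combination z * this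
  cases w
  · simp only [fusedMonodromy, auxEntry, Grading.sgn, Pi.add_apply]
    rw [hst]
    exact hexp _ _ _ _ _ _ (by ring)
  · simp only [fusedMonodromy, auxEntry, Grading.sgn, Pi.add_apply]
    rw [hconj, hconj, hst]
    simp only [← mul_assoc, ← Complex.exp_add]
    simp only [mul_assoc, mul_comm z]
    simp only [← mul_assoc, ← Complex.exp_add]
    congr 2; ring
  · simp only [fusedMonodromy, auxEntry, Grading.sgn, Pi.add_apply]
    rw [hconj, hst]
    simp only [← mul_assoc, ← Complex.exp_add]
    simp only [mul_assoc, mul_comm z]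
    simp only [← mul_assoc, ← Complex.exp_add]
    congr 2; ring

/-! ### Elementary operators -/

/-- The general elementary operator of one block in the symmetrising gauge. -/
def symE (ℓ : ℕ) (η : ℂ) (g : ℕ → ℂ) (i j : ℕ) : Op ℓ := fun c c' =>
  if downCount c = i ∧ downCount c' = j then
    g j / g i * (Complex.exp (η * (-(i * ((ℓ : ℂ) - i)) / 2 + j * ((ℓ : ℂ) - j) / 2)) /
      tiltSum η ℓ j) * Complex.exp (2 * η * tilt c) else 0

theorem opE_eq_conj {Ns ℓ : ℕ} {η : ℂ}
    (hq : ∀ n : ℕ, 1 ≤ n → n ≤ ℓ → qInt (Complex.exp η) n ≠ 0) (hℓ : 1 ≤ ℓ) (w : Grading)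
    (ξ : Fin Ns → ℂ) (g : ℕ → ℂ) (k : Fin Ns) {i j : ℕ} (hi : i ≤ ℓ) (hj : j ≤ ℓ) :
    opE ℓ w η ξ g k i j = expDiag (gaugeExponent ℓ w η ξ) * onBlock k (symE ℓ η g i j) *
      expDiag (-gaugeExponent ℓ w η ξ) := by
  have hp : opE ℓ .principal η ξ g k i j =
      expDiag (gaugeExponent ℓ .principal η ξ) * onBlock k (symE ℓ η g i j) *
      expDiag (-gaugeExponent ℓ .principal η ξ) := by
    refine onBlock_eq_conj (F := blockGaugeExponent ℓ .principal η ξ) fun c c' => ?_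
    rw [Matrix.smul_apply, vecMulVec_ket_bra hq hℓ hi hj, symE]
    split_ifs
    · rw [smul_eq_mul, ← mul_assoc, mul_left_comm (Complex.exp (_ - _)), ← Complex.exp_add]
      congr 2
      simp only [blockGaugeExponent, Grading.sgn]
      ring
    · simp
  have hconj : ∀ f f' : Config (Ns * ℓ) → ℂ,
      expDiag f * (expDiag f' * onBlock k (symE ℓ η g i j) * expDiag (-f')) * expDiag (-f) =
        expDiag (f + f') * onBlock k (symE ℓ η g i j) * expDiag (-(f + f')) := by
    intro f f'
    rw [← expDiag_mul, neg_add_rev, ← expDiag_mul]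
    simp only [Matrix.mul_assoc]
  simp only [opE] at hp
  rw [gaugeExponent_eq]
  cases w
  · simp only [opE, hp]
    rw [gauge_eq_expDiag, expDiag_inv, hconj]
    simp only [Grading.sgn, one_mul]
  · simp only [opE, hp]
    have := hconj (-centerExponent ℓ η ξ) (gaugeExponent ℓ .principal η ξ)
    rw [neg_neg] at this
    rw [gauge_eq_expDiag, expDiag_inv, this]
    simp only [Grading.sgn, neg_one_mul]
    rfl
  · simp only [opE, hp]
    simp only [Grading.sgn, zero_mul]
    rw [show ((fun _ : Config (Ns * ℓ) => (0 : ℂ)) + gaugeExponent ℓ .principal η ξ) =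
      gaugeExponent ℓ .principal η ξ from zero_add _]

/-! ### Spin-1/2 elementary operators as matrix units on a block. -/

theorem onSite_eq_tensorOp {L : ℕ} (k : Fin L) (X : Matrix (Fin 2) (Fin 2) ℂ) :
    onSite k X = tensorOp fun j => if j = k then X else 1 := by
  ext s t
  rw [onSite, tensorOp, ← Finset.mul_prod_erase _ _ (Finset.mem_univ k), if_pos rfl]
  split_ifs with h
  · rw [Finset.prod_eq_one, mul_one]
    intro j hj
    rw [if_neg (Finset.ne_of_mem_erase hj), h j (Finset.ne_of_mem_erase hj), Matrix.one_apply_eq]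
  · push Not at h
    obtain ⟨j, hj, hne⟩ := h
    rw [Finset.prod_eq_zero (Finset.mem_erase.2 ⟨hj, Finset.mem_univ j⟩), mul_zero]
    rw [if_neg hj, Matrix.one_apply_ne hne]

theorem tensorOp_mul {L : ℕ} (X Y : Fin L → Matrix (Fin 2) (Fin 2) ℂ) :
    tensorOp X * tensorOp Y = tensorOp fun j => X j * Y j := by
  ext s t
  simp only [tensorOp, Matrix.mul_apply, ← Finset.prod_mul_distrib]
  rw [Finset.prod_univ_sum]
  simp

theorem tensorOp_one {L : ℕ} : (tensorOp fun _ : Fin L => 1) = 1 := by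
  ext s t
  simp only [tensorOp, Matrix.one_apply]
  rw [Finset.prod_boole]
  simp [funext_iff]

theorem prod_ofFn_tensorOp {L n : ℕ} (X : Fin n → Fin L → Matrix (Fin 2) (Fin 2) ℂ) :
    (List.ofFn fun i => tensorOp (X i)).prod =
      tensorOp fun j => (List.ofFn fun i => X i j).prod := by
  induction n with
  | zero => simpa using tensorOp_one.symm
  | succ n ih =>
    simp only [List.ofFn_succ, List.prod_cons]
    rw [ih fun i => X i.succ, tensorOp_mul]

theorem eBlock_eq_onBlock {Ns ℓ : ℕ} (k : Fin Ns) (a b : Config ℓ) :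
    eBlock k a b = onBlock k (Matrix.single a b 1) := by
  simp only [eBlock, onSite_eq_tensorOp]
  rw [prod_ofFn_tensorOp]
  have hsite : ∀ (c : Fin Ns) (β : Fin ℓ),
      (List.ofFn fun i => if site c β = site k i then eUnit (a i) (b i) else 1).prod =
        if c = k then eUnit (a β) (b β) else 1 := by
    intro c β
    split_ifs with h
    · subst h
      have : ∀ i, site c β = site c i ↔ β = i := fun i => by simp [site]
      simp only [this]
      exact prod_ofFn_ite (fun i => eUnit (a i) (b i)) β
    · refine List.prod_eq_one fun x hx => ?_
      obtain ⟨i, rfl⟩ := (List.mem_ofFn' _ _).1 hx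
      exact if_neg fun h' => h (congrArg Prod.fst (finProdFinEquiv.injective h'))
  ext s t
  rw [tensorOp, ← finProdFinEquiv.prod_comp]
  have hterm : ∀ x : Fin Ns × Fin ℓ,
      (List.ofFn fun i => if finProdFinEquiv x = site k i then eUnit (a i) (b i) else 1).prod
        (s (finProdFinEquiv x)) (t (finProdFinEquiv x)) =
      if (if x.1 = k then a x.2 = s (site x.1 x.2) ∧ b x.2 = t (site x.1 x.2)
        else s (site x.1 x.2) = t (site x.1 x.2)) then 1 else 0 := by
    rintro ⟨c, β⟩
    have := hsite c β
    rw [site] at this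
    rw [this]
    by_cases h : c = k
    · simp only [h, if_true, eUnit, Matrix.single_apply]; rfl
    · simp only [h, if_false, Matrix.one_apply]; rfl
  rw [Finset.prod_congr rfl fun x _ => hterm x, Finset.prod_boole, onBlock, Matrix.single_apply,
    ← ite_and]
  congr 1
  refine propext ?_
  simp only [Finset.mem_univ, true_implies, Prod.forall, funext_iff]
  constructor
  · intro h
    refine ⟨fun c β hc => by simpa [hc] using h c β, fun β => ?_, fun β => ?_⟩
    · simpa using (by simpa using h k β : a β = s (site k β) ∧ b β = t (site k β)).1
    · simpa using (by simpa using h k β : a β = s (site k β) ∧ b β = t (site k β)).2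
  · rintro ⟨h1, h2, h3⟩ c β
    split_ifs with hc
    · subst hc; exact ⟨h2 β, h3 β⟩
    · exact h1 c β hc

theorem vecMul_eBlock {Ns ℓ : ℕ} (k : Fin Ns) (a b : Config ℓ) (u : Config (Ns * ℓ) → ℂ)
    (t : Config (Ns * ℓ)) :
    (u ᵥ* eBlock k a b) t = if getBlock k t = b then u (setBlock k a t) else 0 := by
  rw [eBlock_eq_onBlock, vecMul_onBlock, Finset.sum_eq_single a]
  · simp [Matrix.single_apply, eq_comm]
  · intro c _ hc
    simp [hc.symm]
  · simp

/-! ### Action on symmetric row vectors -/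

/-- A symmetric vector is constant on each class of equal down count in a block, and the entries of
a column of `symProj` on that class sum to one. -/
theorem vecMul_symProjAll {Ns ℓ : ℕ} {η : ℂ}
    (hq : ∀ n : ℕ, 1 ≤ n → n ≤ ℓ → qInt (Complex.exp η) n ≠ 0) {u : Config (Ns * ℓ) → ℂ}
    (hu : ∀ b, BlockSymmetric b u) : u ᵥ* symProjAll η ℓ Ns = u := by
  refine vecMul_list_prod_eq_self fun X hX => ?_
  obtain ⟨b, rfl⟩ := (List.mem_ofFn' _ _).1 hX
  funext t
  rw [vecMul_onBlock]
  have hterm : ∀ c, u (setBlock b c t) * symProj η ℓ c (getBlock b t) =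
      u t / tiltSum η ℓ (downCount (getBlock b t)) *
        if downCount c = downCount (getBlock b t) then Complex.exp (2 * η * tilt c) else 0 := by
    intro c
    rw [symProj]
    split_ifs with h
    · rw [hu b t c _ h, setBlock_getBlock]; ring
    · simp
  rw [Finset.sum_congr rfl fun c _ => hterm c, ← Finset.mul_sum, ← tiltSum_eq_sum_ite,
    div_mul_cancel₀ _ (tiltSum_ne_zero hq (downCount_le _))]

/-- Each projector meets a vector that is already symmetric, so it is absorbed from the left; no
commutation with the monodromy entries is needed. -/
theorem vecMul_prod_symProjAll_conj {Ns ℓ n : ℕ} {η : ℂ}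
    (hq : ∀ n : ℕ, 1 ≤ n → n ≤ ℓ → qInt (Complex.exp η) n ≠ 0) {ξ : Fin Ns → ℂ} (x : Fin n → ℂ)
    (hx : ∀ i, IsRegularParam ℓ η ξ (x i)) (a a' : Fin 2) {u : Config (Ns * ℓ) → ℂ}
    (hu : ∀ b, BlockSymmetric b u) :
    u ᵥ* (List.ofFn fun i => symProjAll η ℓ Ns *
        auxEntry (stringMonodromy ℓ .principal η ξ (x i)) a a' * symProjAll η ℓ Ns).prod =
      u ᵥ* (List.ofFn fun i => auxEntry (stringMonodromy ℓ .principal η ξ (x i)) a a').prod := by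
  induction n generalizing u with
  | zero => simp
  | succ n ih =>
    have hu' : ∀ b, BlockSymmetric b
        (u ᵥ* auxEntry (stringMonodromy ℓ .principal η ξ (x 0)) a a') :=
      fun b => (hu b).vecMul_auxEntry (hx 0) a a'
    rw [List.ofFn_succ, List.ofFn_succ, List.prod_cons, List.prod_cons, ← vecMul_vecMul,
      ← vecMul_vecMul, ← vecMul_vecMul, ← vecMul_vecMul, vecMul_symProjAll hq hu,
      vecMul_symProjAll hq hu', ih (fun i => x i.succ) (fun i => hx i.succ) hu']

theorem blockSymmetric_vecMul_prod {Ns ℓ n : ℕ} {η : ℂ} {ξ : Fin Ns → ℂ} (x : Fin n → ℂ)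
    (hx : ∀ i, IsRegularParam ℓ η ξ (x i)) (a a' : Fin 2) {u : Config (Ns * ℓ) → ℂ} {b : Fin Ns}
    (hu : BlockSymmetric b u) :
    BlockSymmetric b
      (u ᵥ* (List.ofFn fun i => auxEntry (stringMonodromy ℓ .principal η ξ (x i)) a a').prod) := by
  induction n generalizing u with
  | zero => simpa using hu
  | succ n ih =>
    rw [List.ofFn_succ, List.prod_cons, ← vecMul_vecMul]
    exact ih (fun i => x i.succ) (fun i => hx i.succ) (hu.vecMul_auxEntry (hx 0) a a')

theorem blockSymmetric_vac {Ns ℓ : ℕ} (b : Fin Ns) : BlockSymmetric b (vac (Ns * ℓ)) := by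
  refine BlockSymmetric.of_swap fun i hi s => ?_
  have : (s ∘ Equiv.swap (site b ⟨i, by omega⟩) (site b ⟨i + 1, hi⟩) = fun _ => 0) ↔
      s = fun _ => 0 := by
    rw [← Equiv.eq_comp_symm]; rfl
  simp only [vac, Pi.single_apply, this]

/-- By symmetry `u` takes one value, its value at `a`, on everything summed over. The remaining
weights add up to `tiltSum η ℓ i`, which gives the ratio of q-binomials. -/
theorem vecMul_onBlock_symE {Ns ℓ : ℕ} {η : ℂ}
    (hq : ∀ n : ℕ, 1 ≤ n → n ≤ ℓ → qInt (Complex.exp η) n ≠ 0) (g : ℕ → ℂ) {k : Fin Ns}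
    {i j : ℕ} (hi : i ≤ ℓ) (hj : j ≤ ℓ) {a : Config ℓ} (ha : a ∈ seqs ℓ i)
    {u : Config (Ns * ℓ) → ℂ} (hu : BlockSymmetric k u) (t : Config (Ns * ℓ)) :
    (u ᵥ* onBlock k (symE ℓ η g i j)) t =
      if downCount (getBlock k t) = j then normHat ℓ η g i j * u (setBlock k a t) else 0 := by
  rw [vecMul_onBlock]
  split_ifs with h
  · have hterm : ∀ c, u (setBlock k c t) * symE ℓ η g i j c (getBlock k t) =
        u (setBlock k a t) * (g j / g i *
          (Complex.exp (η * (-(i * ((ℓ : ℂ) - i)) / 2 + j * ((ℓ : ℂ) - j) / 2)) /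
            tiltSum η ℓ j)) *
          if downCount c = i then Complex.exp (2 * η * tilt c) else 0 := by
      intro c
      rw [symE]
      by_cases hc : downCount c = i
      · rw [if_pos ⟨hc, h⟩, if_pos hc, hu t c a (hc.trans (mem_seqs.1 ha).symm)]; ring
      · rw [if_neg fun h' => hc h'.1, if_neg hc, mul_zero, mul_zero]
    rw [Finset.sum_congr rfl fun c _ => hterm c, ← Finset.mul_sum, ← tiltSum_eq_sum_ite, normHat,
      qBinom_eq_tiltSum hq hi, qBinom_eq_tiltSum hq hj]
    ring
  · refine Finset.sum_eq_zero fun c _ => ?_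
    rw [symE, if_neg fun h' => h h'.2, mul_zero]

theorem vecMul_onBlock_symE_eq_sum {Ns ℓ : ℕ} {η : ℂ}
    (hq : ∀ n : ℕ, 1 ≤ n → n ≤ ℓ → qInt (Complex.exp η) n ≠ 0) (g : ℕ → ℂ) {k : Fin Ns}
    {i j : ℕ} (hi : i ≤ ℓ) (hj : j ≤ ℓ) {a : Config ℓ} (ha : a ∈ seqs ℓ i)
    {u : Config (Ns * ℓ) → ℂ} (hu : BlockSymmetric k u) :
    u ᵥ* onBlock k (symE ℓ η g i j) =
      normHat ℓ η g i j • ∑ b ∈ seqs ℓ j, u ᵥ* eBlock k a b := by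
  funext t
  rw [vecMul_onBlock_symE hq g hi hj ha hu, Pi.smul_apply, Finset.sum_apply,
    Finset.sum_congr rfl fun b _ => vecMul_eBlock k a b u t, Finset.sum_ite_eq, smul_eq_mul,
    mul_ite, mul_zero]
  simp only [mem_seqs]

theorem BlockSymmetric.vecMul_symE {Ns ℓ : ℕ} {η : ℂ}
    (hq : ∀ n : ℕ, 1 ≤ n → n ≤ ℓ → qInt (Complex.exp η) n ≠ 0) (g : ℕ → ℂ) {k b : Fin Ns}
    {i j : ℕ} (hi : i ≤ ℓ) (hj : j ≤ ℓ) {a : Config ℓ} (ha : a ∈ seqs ℓ i)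
    {u : Config (Ns * ℓ) → ℂ} (hk : BlockSymmetric k u) (hb : BlockSymmetric b u) :
    BlockSymmetric b (u ᵥ* onBlock k (symE ℓ η g i j)) := by
  intro t c c' h
  rw [vecMul_onBlock_symE hq g hi hj ha hk, vecMul_onBlock_symE hq g hi hj ha hk]
  by_cases hbk : k = b
  · subst hbk
    rw [getBlock_setBlock, getBlock_setBlock, setBlock_setBlock, setBlock_setBlock, h]
  · rw [getBlock_setBlock_of_ne hbk, getBlock_setBlock_of_ne hbk, setBlock_comm hbk,
      setBlock_comm hbk, hb _ c c' h]

theorem sum_piFinset_succ {α A : Type*} [DecidableEq α] [AddCommMonoid A] {m : ℕ}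
    (S : Fin (m + 1) → Finset α) (F : (Fin (m + 1) → α) → A) :
    ∑ b ∈ Fintype.piFinset S, F b =
      ∑ b₀ ∈ S 0, ∑ b ∈ Fintype.piFinset fun k => S k.succ, F (Fin.cons b₀ b) := by
  rw [← Finset.sum_product']
  refine Finset.sum_nbij' (fun b => (b 0, fun k => b k.succ)) (fun p => Fin.cons p.1 p.2) ?_ ?_ ?_
    ?_ ?_
  · intro b hb
    rw [Fintype.mem_piFinset] at hb
    exact Finset.mem_product.2 ⟨hb 0, Fintype.mem_piFinset.2 fun k => hb k.succ⟩
  · rintro ⟨b₀, b⟩ hb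
    rw [Finset.mem_product, Fintype.mem_piFinset] at hb
    exact Fintype.mem_piFinset.2 fun k => Fin.cases hb.1 hb.2 k
  · intro b _
    exact Fin.cons_self_tail b
  · intro p _
    rfl
  · intro b _
    exact congrArg F (Fin.cons_self_tail b).symm

/-- Each `symE` factor returns a vector symmetric in every block, so expansion can proceed factor by
factor, even if blocks repeat. -/
theorem vecMul_prod_symE {Ns ℓ m : ℕ} {η : ℂ}
    (hq : ∀ n : ℕ, 1 ≤ n → n ≤ ℓ → qInt (Complex.exp η) n ≠ 0) (g : ℕ → ℂ) (k : Fin m → Fin Ns)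
    (i j : Fin m → ℕ) (hi : ∀ r, i r ≤ ℓ) (hj : ∀ r, j r ≤ ℓ) (a : Fin m → Config ℓ)
    (ha : ∀ r, a r ∈ seqs ℓ (i r)) {u : Config (Ns * ℓ) → ℂ} (hu : ∀ b, BlockSymmetric b u) :
    u ᵥ* (List.ofFn fun r => onBlock (k r) (symE ℓ η g (i r) (j r))).prod =
      (∏ r, normHat ℓ η g (i r) (j r)) • ∑ b ∈ Fintype.piFinset fun r => seqs ℓ (j r),
        u ᵥ* (List.ofFn fun r => eBlock (k r) (a r) (b r)).prod := by
  induction m generalizing u with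
  | zero => simp
  | succ m ih =>
    rw [List.ofFn_succ, List.prod_cons, ← vecMul_vecMul,
      ih (fun r => k r.succ) (fun r => i r.succ) (fun r => j r.succ) (fun r => hi r.succ)
        (fun r => hj r.succ) (fun r => a r.succ) (fun r => ha r.succ)
        fun b => BlockSymmetric.vecMul_symE hq g (hi 0) (hj 0) (ha 0) (hu _) (hu b),
      vecMul_onBlock_symE_eq_sum hq g (hi 0) (hj 0) (ha 0) (hu _), sum_piFinset_succ,
      Fin.prod_univ_succ, mul_comm (normHat ℓ η g (i 0) (j 0)), mul_smul]
    congr 1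
    simp only [List.ofFn_succ, List.prod_cons, Fin.cons_zero, Fin.cons_succ, smul_vecMul,
      sum_vecMul, vecMul_vecMul]
    rw [Finset.sum_comm, Finset.smul_sum]

theorem BlockSymmetric.vecMul_eBlock_of_ne {Ns ℓ : ℕ} {k b : Fin Ns} (hkb : k ≠ b)
    {u : Config (Ns * ℓ) → ℂ} (hb : BlockSymmetric b u) (a a' : Config ℓ) :
    BlockSymmetric b (u ᵥ* eBlock k a a') := by
  intro t c c' h
  rw [vecMul_eBlock, vecMul_eBlock, getBlock_setBlock_of_ne hkb, getBlock_setBlock_of_ne hkb,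
    setBlock_comm hkb, setBlock_comm hkb, hb _ c c' h]

/-- A single `eBlock`, unlike the full sum, can destroy symmetry in its own block. Injectivity of
`k` ensures that each later block is still untouched when its turn comes. -/
theorem vecMul_prod_eBlock_congr {Ns ℓ m : ℕ} {k : Fin m → Fin Ns} (hk : Function.Injective k)
    {a a' : Fin m → Config ℓ} (h : ∀ r, downCount (a r) = downCount (a' r)) (b : Fin m → Config ℓ)
    {u : Config (Ns * ℓ) → ℂ} (hu : ∀ r, BlockSymmetric (k r) u) :
    u ᵥ* (List.ofFn fun r => eBlock (k r) (a r) (b r)).prod =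
      u ᵥ* (List.ofFn fun r => eBlock (k r) (a' r) (b r)).prod := by
  induction m generalizing u with
  | zero => simp
  | succ m ih =>
    have h0 : u ᵥ* eBlock (k 0) (a 0) (b 0) = u ᵥ* eBlock (k 0) (a' 0) (b 0) := by
      funext t
      rw [vecMul_eBlock, vecMul_eBlock, hu 0 t _ _ (h 0)]
    rw [List.ofFn_succ, List.ofFn_succ, List.prod_cons, List.prod_cons, ← vecMul_vecMul,
      ← vecMul_vecMul, h0]
    refine ih (fun r s hrs => Fin.succ_injective _ (hk hrs)) (fun r => h r.succ) _ fun r => ?_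
    exact (hu r.succ).vecMul_eBlock_of_ne (fun h' => Fin.succ_ne_zero r (hk h').symm) _ _

/-! ### Matrix elements -/

theorem vev_eq {L : ℕ} (X : Op L) : vev X = (vac L ᵥ* X) fun _ => 0 := by
  rw [vev, dotProduct_mulVec, vac]
  simp

theorem vev_smul {L : ℕ} (c : ℂ) (X : Op L) : vev (c • X) = c * vev X := by
  rw [vev_eq, vev_eq, vecMul_smul]; rfl

theorem gaugeExponent_zero {Ns : ℕ} (ℓ : ℕ) (w : Grading) (η : ℂ) (ξ : Fin Ns → ℂ) :
    gaugeExponent ℓ w η ξ (fun _ => 0) = 0 := by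
  refine Finset.sum_eq_zero fun b _ => ?_
  simp [blockGaugeExponent, getBlock, downCount, tilt]

theorem vev_expDiag_conj {L : ℕ} {f : Config L → ℂ} (hf : f (fun _ => 0) = 0) (X : Op L) :
    vev (expDiag f * X * expDiag (-f)) = vev X := by
  have : ∀ Y : Op L, vev Y = Y (fun _ => 0) (fun _ => 0) := by
    intro Y; rw [vev_eq, vac, single_vecMul]; simp
  rw [this, this, expDiag_conj_apply, Pi.neg_apply, hf]
  simp

theorem blockSymmetric_vecMul_prod_symE {Ns ℓ m : ℕ} {η : ℂ}
    (hq : ∀ n : ℕ, 1 ≤ n → n ≤ ℓ → qInt (Complex.exp η) n ≠ 0) (g : ℕ → ℂ) (k : Fin m → Fin Ns)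
    (i j : Fin m → ℕ) (hi : ∀ r, i r ≤ ℓ) (hj : ∀ r, j r ≤ ℓ) (a : Fin m → Config ℓ)
    (ha : ∀ r, a r ∈ seqs ℓ (i r)) {u : Config (Ns * ℓ) → ℂ} (hu : ∀ b, BlockSymmetric b u)
    (b : Fin Ns) :
    BlockSymmetric b
      (u ᵥ* (List.ofFn fun r => onBlock (k r) (symE ℓ η g (i r) (j r))).prod) := by
  induction m generalizing u with
  | zero => simpa using hu b
  | succ m ih =>
    rw [List.ofFn_succ, List.prod_cons, ← vecMul_vecMul]
    exact ih (fun r => k r.succ) (fun r => i r.succ) (fun r => j r.succ) (fun r => hi r.succ)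
      (fun r => hj r.succ) (fun r => a r.succ) (fun r => ha r.succ)
      fun b => BlockSymmetric.vecMul_symE hq g (hi 0) (hj 0) (ha 0) (hu _) (hu b)

/-- The entries of the spin-`ℓ/2` monodromy matrix in the symmetrising gauge. -/
def symEntry {Ns : ℕ} (ℓ : ℕ) (η : ℂ) (ξ : Fin Ns → ℂ) (a b : Fin 2) (x : ℂ) : Op (Ns * ℓ) :=
  symProjAll η ℓ Ns * auxEntry (stringMonodromy ℓ .principal η ξ x) a b * symProjAll η ℓ Ns

theorem opC_eq_conj {Ns ℓ : ℕ} {η : ℂ}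
    (hq : ∀ n : ℕ, 1 ≤ n → n ≤ ℓ → qInt (Complex.exp η) n ≠ 0) (hℓ : 1 ≤ ℓ) (w : Grading)
    (ξ : Fin Ns → ℂ) (x : ℂ) :
    opC ℓ w η ξ x = Complex.exp (w.sgn * x) • (expDiag (gaugeExponent ℓ w η ξ) *
      symEntry ℓ η ξ 1 0 x * expDiag (-gaugeExponent ℓ w η ξ)) := by
  rw [opC, auxEntry_fusedMonodromy hq hℓ, symEntry, if_pos rfl, if_neg zero_ne_one, sub_zero]

theorem opB_eq_conj {Ns ℓ : ℕ} {η : ℂ}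
    (hq : ∀ n : ℕ, 1 ≤ n → n ≤ ℓ → qInt (Complex.exp η) n ≠ 0) (hℓ : 1 ≤ ℓ) (w : Grading)
    (ξ : Fin Ns → ℂ) (x : ℂ) :
    opB ℓ w η ξ x = Complex.exp (-(w.sgn * x)) • (expDiag (gaugeExponent ℓ w η ξ) *
      symEntry ℓ η ξ 0 1 x * expDiag (-gaugeExponent ℓ w η ξ)) := by
  rw [opB, auxEntry_fusedMonodromy hq hℓ, symEntry, if_pos rfl, if_neg zero_ne_one, zero_sub,
    mul_neg]

theorem vev_gauge_conj {L N m M : ℕ} {f : Config L → ℂ} (hf : f (fun _ => 0) = 0)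
    (c : Fin N → ℂ) (d : Fin M → ℂ) (X : Fin N → Op L) (Y : Fin m → Op L) (Z : Fin M → Op L) :
    vev ((List.ofFn fun α => c α • (expDiag f * X α * expDiag (-f))).prod *
        (List.ofFn fun r => expDiag f * Y r * expDiag (-f)).prod *
        (List.ofFn fun β => d β • (expDiag f * Z β * expDiag (-f))).prod) =
      ((∏ α, c α) * ∏ β, d β) *
        vev ((List.ofFn X).prod * (List.ofFn Y).prod * (List.ofFn Z).prod) := by
  have hconj : ∀ X Y Z : Op L,
      expDiag f * X * expDiag (-f) * (expDiag f * Y * expDiag (-f)) *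
        (expDiag f * Z * expDiag (-f)) = expDiag f * (X * Y * Z) * expDiag (-f) := by
    intro X Y Z
    have h := prod_map_conj (expDiag_mul_neg f) (expDiag_neg_mul f) [X, Y, Z]
    simpa only [List.map_cons, List.map_nil, List.prod_cons, List.prod_nil, mul_one, mul_assoc]
      using h
  rw [prod_ofFn_smul, prod_ofFn_smul, prod_ofFn_conj (expDiag_mul_neg _) (expDiag_neg_mul _),
    prod_ofFn_conj (expDiag_mul_neg _) (expDiag_neg_mul _),
    prod_ofFn_conj (expDiag_mul_neg _) (expDiag_neg_mul _), Matrix.smul_mul, smul_mul_smul_comm,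
    vev_smul, hconj, vev_expDiag_conj hf]

theorem vev_prod_symEntry {Ns ℓ N M m : ℕ} {η : ℂ}
    (hq : ∀ n : ℕ, 1 ≤ n → n ≤ ℓ → qInt (Complex.exp η) n ≠ 0)
    {ξ : Fin Ns → ℂ} (g : ℕ → ℂ) {μ : Fin N → ℂ} {lam : Fin M → ℂ}
    (hμ : ∀ α, IsRegularParam ℓ η ξ (μ α)) (hlam : ∀ β, IsRegularParam ℓ η ξ (lam β))
    (k : Fin m → Fin Ns) (i j : Fin m → ℕ) (hi : ∀ r, i r ≤ ℓ) (hj : ∀ r, j r ≤ ℓ)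
    (a : Fin m → Config ℓ) (ha : ∀ r, a r ∈ seqs ℓ (i r)) :
    vev ((List.ofFn fun α => symEntry ℓ η ξ 1 0 (μ α)).prod *
        (List.ofFn fun r => onBlock (k r) (symE ℓ η g (i r) (j r))).prod *
        (List.ofFn fun β => symEntry ℓ η ξ 0 1 (lam β)).prod) =
      (∏ r, normHat ℓ η g (i r) (j r)) *
        ∑ b ∈ Fintype.piFinset fun r => seqs ℓ (j r),
          halfElement ℓ .principal η ξ μ lam
            (List.ofFn fun r => eBlock (k r) (a r) (b r)).prod := by
  have hvac := fun b : Fin Ns => blockSymmetric_vac (ℓ := ℓ) b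
  simp only [halfElement, vev_eq, opB0, opC0, ← vecMul_vecMul]
  generalize vac (Ns * ℓ) = v at hvac ⊢
  have hsym := fun b : Fin Ns => blockSymmetric_vecMul_prod μ hμ 1 0 (hvac b)
  have hC := vecMul_prod_symProjAll_conj hq μ hμ 1 0 hvac
  -- The vector reaching the `B` operators is symmetric only while the elementary operators remain
  -- unexpanded, so their projectors are removed before the expansion `hE`.
  have hB := vecMul_prod_symProjAll_conj hq lam hlam 0 1
    (blockSymmetric_vecMul_prod_symE hq g k i j hi hj a ha hsym)
  have hE := vecMul_prod_symE hq g k i j hi hj a ha hsym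
  simp only [symEntry]
  rw [hC, hB, hE, smul_vecMul, sum_vecMul, Pi.smul_apply, Finset.sum_apply, smul_eq_mul]

theorem fusedElement_prod_opE {Ns ℓ N M m : ℕ} {η : ℂ}
    (hq : ∀ n : ℕ, 1 ≤ n → n ≤ ℓ → qInt (Complex.exp η) n ≠ 0) (hℓ : 1 ≤ ℓ) (w : Grading)
    {ξ : Fin Ns → ℂ} (g : ℕ → ℂ) {μ : Fin N → ℂ} {lam : Fin M → ℂ}
    (hμ : ∀ α, IsRegularParam ℓ η ξ (μ α)) (hlam : ∀ β, IsRegularParam ℓ η ξ (lam β))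
    (k : Fin m → Fin Ns) (i j : Fin m → ℕ) (hi : ∀ r, i r ≤ ℓ) (hj : ∀ r, j r ≤ ℓ)
    (a : Fin m → Config ℓ) (ha : ∀ r, a r ∈ seqs ℓ (i r)) :
    fusedElement ℓ w η ξ μ lam (List.ofFn fun r => opE ℓ w η ξ g (k r) (i r) (j r)).prod =
      (∏ r, normHat ℓ η g (i r) (j r)) * Complex.exp (w.sgn * (∑ α, μ α - ∑ β, lam β)) *
        ∑ b ∈ Fintype.piFinset fun r => seqs ℓ (j r),
          halfElement ℓ .principal η ξ μ lam
            (List.ofFn fun r => eBlock (k r) (a r) (b r)).prod := by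
  have hcoef : (∏ α, Complex.exp (w.sgn * μ α)) * ∏ β, Complex.exp (-(w.sgn * lam β)) =
      Complex.exp (w.sgn * (∑ α, μ α - ∑ β, lam β)) := by
    rw [← Complex.exp_sum, ← Complex.exp_sum, ← Complex.exp_add, Finset.sum_neg_distrib,
      ← Finset.mul_sum, ← Finset.mul_sum]
    congr 1; ring
  rw [fusedElement, funext fun α => opC_eq_conj hq hℓ w ξ (μ α),
    funext fun β => opB_eq_conj hq hℓ w ξ (lam β),
    funext fun r => opE_eq_conj hq hℓ w ξ g (k r) (hi r) (hj r),
    vev_gauge_conj (gaugeExponent_zero ℓ w η ξ), hcoef,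
    vev_prod_symEntry hq g hμ hlam k i j hi hj a ha, mul_left_comm, mul_assoc]

theorem halfElement_prod_eBlock_congr {Ns ℓ N M m : ℕ} {η : ℂ} {ξ : Fin Ns → ℂ} {μ : Fin N → ℂ}
    (lam : Fin M → ℂ) (hμ : ∀ α, IsRegularParam ℓ η ξ (μ α)) {k : Fin m → Fin Ns}
    (hk : Function.Injective k) {a a' : Fin m → Config ℓ}
    (h : ∀ r, downCount (a r) = downCount (a' r)) (b : Fin m → Config ℓ) :
    halfElement ℓ .principal η ξ μ lam (List.ofFn fun r => eBlock (k r) (a r) (b r)).prod =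
      halfElement ℓ .principal η ξ μ lam (List.ofFn fun r => eBlock (k r) (a' r) (b r)).prod := by
  simp only [halfElement, vev_eq, ← vecMul_vecMul, opC0]
  rw [vecMul_prod_eBlock_congr hk h b fun r =>
    blockSymmetric_vecMul_prod μ hμ 1 0 (blockSymmetric_vac (k r))]

end HigherSpinXXZ

end

open HigherSpinXXZ
theorem proposition4p2 (ℓ Ns : ℕ) (hℓ : 1 ≤ ℓ) (hNs : 1 ≤ Ns) (η : ℂ)
    (hq : ∀ n : ℕ, 1 ≤ n → n ≤ ℓ → qInt (Complex.exp η) n ≠ 0)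
    (ξ : Fin Ns → ℂ) (g : ℕ → ℂ) (hg : ∀ n ≤ ℓ, g n ≠ 0) (w : Grading)
    (N M : ℕ) (μ : Fin N → ℂ) (lam : Fin M → ℂ)
    (hμ : ∀ α, IsRegularParam ℓ η ξ (μ α)) (hlam : ∀ β, IsRegularParam ℓ η ξ (lam β)) :
    -- one operator, acting on the first spin-`ℓ/2` site
    (∀ i j : ℕ, i ≤ ℓ → j ≤ ℓ → (i : ℤ) - (j : ℤ) = (N : ℤ) - (M : ℤ) →
      ∀ a ∈ seqs ℓ i,
        fusedElement ℓ w η ξ μ lam (opE ℓ w η ξ g ⟨0, hNs⟩ i j) =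
            normHat ℓ η g i j *
              Complex.exp (w.sgn * (∑ α, μ α - ∑ β, lam β)) *
              ∑ b ∈ seqs ℓ j,
                halfElement ℓ .principal η ξ μ lam (eBlock ⟨0, hNs⟩ a b) ∧
        ∀ b ∈ seqs ℓ j, ∀ π : Equiv.Perm (Fin ℓ),
          halfElement ℓ .principal η ξ μ lam (eBlock ⟨0, hNs⟩ (fun β => a (π β)) b) =
            halfElement ℓ .principal η ξ μ lam (eBlock ⟨0, hNs⟩ a b)) ∧
    -- products of `m` operators, acting on the first `m` spin-`ℓ/2` sites
    (∀ (m : ℕ) (hm : m ≤ Ns) (i j : Fin m → ℕ), (∀ k, i k ≤ ℓ) → (∀ k, j k ≤ ℓ) →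
      (∑ k, (i k : ℤ)) - ∑ k, (j k : ℤ) = (N : ℤ) - (M : ℤ) →
      ∀ a : Fin m → Fin ℓ → Fin 2, (∀ k, a k ∈ seqs ℓ (i k)) →
        fusedElement ℓ w η ξ μ lam
            (List.ofFn fun k : Fin m => opE ℓ w η ξ g (Fin.castLE hm k) (i k) (j k)).prod =
            (∏ k, normHat ℓ η g (i k) (j k)) *
              Complex.exp (w.sgn * (∑ α, μ α - ∑ β, lam β)) *
              ∑ b ∈ Fintype.piFinset fun k => seqs ℓ (j k),
                halfElement ℓ .principal η ξ μ lam
                  (List.ofFn fun k : Fin m => eBlock (Fin.castLE hm k) (a k) (b k)).prod ∧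
        ∀ b : Fin m → Fin ℓ → Fin 2, (∀ k, b k ∈ seqs ℓ (j k)) →
          ∀ π : Fin m → Equiv.Perm (Fin ℓ),
            halfElement ℓ .principal η ξ μ lam
                (List.ofFn fun k : Fin m =>
                  eBlock (Fin.castLE hm k) (fun β => a k (π k β)) (b k)).prod =
              halfElement ℓ .principal η ξ μ lam
                (List.ofFn fun k : Fin m => eBlock (Fin.castLE hm k) (a k) (b k)).prod) := by
  have hgen := fun (m : ℕ) (hm : m ≤ Ns) (i j : Fin m → ℕ) (hi : ∀ k, i k ≤ ℓ)
      (hj : ∀ k, j k ≤ ℓ) (a : Fin m → Fin ℓ → Fin 2) (ha : ∀ k, a k ∈ seqs ℓ (i k)) =>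
    fusedElement_prod_opE hq hℓ w g hμ hlam (Fin.castLE hm) i j hi hj a ha
  have hperm := fun (m : ℕ) (hm : m ≤ Ns) (a b : Fin m → Fin ℓ → Fin 2)
      (π : Fin m → Equiv.Perm (Fin ℓ)) =>
    halfElement_prod_eBlock_congr lam hμ (Fin.castLE_injective hm)
      (a := fun k β => a k (π k β)) (a' := a) (fun k => downCount_comp_perm (a k) (π k)) b
  have h0 : Fin.castLE hNs 0 = ⟨0, hNs⟩ := rfl
  refine ⟨fun i j hi hj _ a ha => ⟨?_, fun b _ π => ?_⟩,
    fun m hm i j hi hj _ a ha => ⟨hgen m hm i j hi hj a ha, fun b _ π => hperm m hm a b π⟩⟩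
  -- The one-operator formula is the case `m = 1` with constant families; the sum over `Fin
  -- 1`-indexed families unfolds to a single sum.
  · have h := hgen 1 hNs (fun _ => i) (fun _ => j) (fun _ => hi) (fun _ => hj) (fun _ => a)
      fun _ => ha
    rw [sum_piFinset_succ] at h
    simpa [h0] using h
  · simpa [h0] using hperm 1 hNs (fun _ => a) (fun _ => b) fun _ => π
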